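/- Let $G$ be a countably infinite (discrete) group with identity $e$, let $\mu$ be a probability measure on $G$, and let $\alpha\in[0,1)$. A *generalized step-reinforced random walk* on $G$ with parameter $\alpha$ and step distribution $\mu$ is a process $S=(S_n)_{n\ge 0}$ built as follows on some probability space. Let $(\xi_n)_{n\ge2}$ be i.i.d. Bernoulli($\alpha$) variables and, independently, let $(u_n)_{n\ge2}$ be independent with $u_n$ uniform on $\{1,\dots,n-1\}$. Let $(T_n)_{n\ge2}$ be random maps $T_n:G\to G$ such that $T_n$ is independent of $(\xi_k,u_k)_{k\ge n}$ for each $n$. Let $(g_n)_{n\ge1}$ be i.i.d. samples from $\mu$, independent of $\big((\xi_n)_n,(u_n)_n,(T_n)_n\big)$. Put $X_1:=g_1$ and, for $n\ge2$, $X_n:=T_n(X_{u_n})$ if $\xi_n=1$ and $X_n:=g_n$ if $\xi_n=0$; put $S_0:=e$ and $S_n:=S_{n-1}X_n$ for $n\ge 1$. Assume that the transition matrix $P_\mu(x,y)=\mu(x^{-1}y)$ is irreducible, that $\mu(e)\ge\mu_0$ for some $\mu_0\in(0,1/2]$, and that the support $\Gamma=\{x\in G:\mu(x)>0\}$ is finite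 and generates $G$. Let $G_\Gamma$ be the (undirected) Cayley graph of $G$ with respect to $\Gamma$ and let $B(n)$ be the ball of radius $n$ around $e$ in $G_\Gamma$. (i) Suppose that $G_\Gamma$ has polynomial growth of degree $d\ge1$, that is, $c\,n^d\le|B(n)|\le C\,n^d$ for some constants $c,C>0$ and all $n\ge1$. Then there is a constant $C_1=C_1(G,\mu,\alpha)>0$ such that for every generalized step-reinforced random walk $S$ on $G$ with parameter $\alpha$ and step distribution $\mu$, $$\max_{x\in G}\mathbb P(S_n=x)\le C_1\,n^{-d/2}\qquad\text{for all } n\ge1.$$ If $G_\Gamma$ has at least cubic growth, that is, $|B(n)|\ge c\,n^3$ for some $c>0$ and all $n\ge1$, then every such $S$ is transient: almost surely, $S$ visits every finite subset of $G$ only finitely often. (ii) Suppose that $G_\Gamma$ has exponential growth, that is, for some $b>1$ one has $|B(n)|\ge b^n$ for all large $n$. Then there are constants $C_2,C_3>0$ depending only on $G$, $\mu$, $\alpha$ such that for every such $S$, $$\max_{x\in G}\mathbb P(S_n=x)\le C_2\,e^{-C_3n^{1/3}}\qquad\text{for all } n\ge1.$$ (iii) Suppose that $G_\Gamma$ is nonamenable,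 that is, $$\inf\left\{\frac{|\{(x,y)\in E(G_\Gamma): x\in A,\ y\in A^c\}|}{|A|}:\ \emptyset\ne A\subset G,\ A\text{ finite}\right\}>0.$$ Then there are constants $C_4,C_5>0$ depending only on $G$, $\mu$, $\alpha$ such that for every such $S$, $$\max_{x\in G}\mathbb P(S_n=x)\le C_4\,e^{-C_5n}\qquad\text{for all } n\ge1.$$ -/

import Mathlib

open MeasureTheory ProbabilityTheory Filter
open scoped ENNReal

namespace SRRW

/-- The support `Γ = {x : μ(x) > 0}` of a measure on a discrete space. -/
def stepSupport {G : Type*} [MeasurableSpace G] (μ : Measure G) : Set G :=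
  {x | 0 < μ {x}}

/-- The transition matrix `P_μ(x, y) = μ(x⁻¹ y)`. -/
noncomputable def transition {G : Type*} [Group G] [MeasurableSpace G]
    (μ : Measure G) (x y : G) : ℝ≥0∞ :=
  μ {x⁻¹ * y}

open Classical in
/-- The entries of the `n`-th power of the transition matrix `P_μ`. -/
noncomputable def transitionPow {G : Type*} [Group G] [MeasurableSpace G]
    (μ : Measure G) : ℕ → G → G → ℝ≥0∞
  | 0, x, y => if x = y then 1 else 0
  | n + 1, x, y => ∑' z, transition μ x z * transitionPow μ n z y

/-- Irreducibility of the transition matrix `P_μ`. -/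
def IsIrreducibleStep {G : Type*} [Group G] [MeasurableSpace G] (μ : Measure G) : Prop :=
  ∀ x y : G, ∃ n : ℕ, 0 < transitionPow μ n x y

/-- `X` and `S` are the step sequence and the walk of the generalized step-reinforced random walk
on the discrete group `G` that is driven, on the probability space `(Ω, P)`, by the coins `ξ n` and
the uniform past times `u n` (`n ≥ 2`), the random transformations `T n` (`n ≥ 2`) and the fresh
samples `g n` (`n ≥ 1`) from `μ`. Values of the sequences at smaller indices are irrelevant. -/
structure IsDrivenBy {G : Type*} [Group G] [MeasurableSpace G] {Ω : Type*} [MeasurableSpace Ω]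
    (P : Measure Ω) (α : ℝ) (μ : Measure G)
    (ξ : ℕ → Ω → Bool) (u : ℕ → Ω → ℕ) (T : ℕ → Ω → G → G) (g : ℕ → Ω → G)
    (X S : ℕ → Ω → G) : Prop where
  /-- the coins are Bernoulli with success parameter `α` -/
  measurable_coin : ∀ n, 2 ≤ n → Measurable (ξ n)
  coin_law : ∀ n, 2 ≤ n → P {ω | ξ n ω = true} = ENNReal.ofReal α
  /-- `u n` is uniform on `{1, …, n - 1}` -/
  measurable_time : ∀ n, 2 ≤ n → Measurable (u n)
  time_mem : ∀ n, 2 ≤ n → ∀ ω, u n ω ∈ Finset.Icc 1 (n - 1)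
  time_law : ∀ n, 2 ≤ n → ∀ k ∈ Finset.Icc 1 (n - 1),
    P {ω | u n ω = k} = ((n - 1 : ℕ) : ℝ≥0∞)⁻¹
  /-- all the coins and all the times are mutually independent -/
  indep_coin : iIndepFun (fun (n : {n : ℕ // 2 ≤ n}) => ξ n) P
  indep_time : iIndepFun (fun (n : {n : ℕ // 2 ≤ n}) => u n) P
  indep_coin_time : IndepFun (fun ω (n : {n : ℕ // 2 ≤ n}) => ξ n ω)
    (fun ω (n : {n : ℕ // 2 ≤ n}) => u n ω) P
  /-- `T n` is a random transformation of `G`, independent of the coins and times from `n` on -/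
  measurable_map : ∀ n, 2 ≤ n → Measurable (T n)
  indep_map : ∀ n, 2 ≤ n →
    IndepFun (T n) (fun ω (k : {k : ℕ // n ≤ k}) => (ξ k ω, u k ω)) P
  /-- the fresh samples are i.i.d. with law `μ` -/
  measurable_fresh : ∀ n, 1 ≤ n → Measurable (g n)
  fresh_law : ∀ n, 1 ≤ n → P.map (g n) = μ
  indep_fresh : iIndepFun (fun (n : {n : ℕ // 1 ≤ n}) => g n) P
  /-- the fresh samples are drawn independently of the coins, times and transformations -/
  indep_fresh_drive : IndepFun (fun ω (n : {n : ℕ // 1 ≤ n}) => g n ω)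
    (fun ω (n : {n : ℕ // 2 ≤ n}) => (ξ n ω, u n ω, T n ω)) P
  /-- the recursion for the steps and for the walk -/
  step_one : ∀ ω, X 1 ω = g 1 ω
  step_succ : ∀ n, 2 ≤ n → ∀ ω,
    X n ω = if ξ n ω = true then T n ω (X (u n ω) ω) else g n ω
  walk_zero : ∀ ω, S 0 ω = 1
  walk_succ : ∀ n ω, S (n + 1) ω = S n ω * X (n + 1) ω

/-- `S` is a generalized step-reinforced random walk on `G` started at the identity, with
reinforcement parameter `α` and step distribution `μ` (and some transformations). -/
def IsGeneralizedSRRW {G : Type*} [Group G] [MeasurableSpace G] {Ω : Type*} [MeasurableSpace Ω]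
    (P : Measure Ω) (α : ℝ) (μ : Measure G) (S : ℕ → Ω → G) : Prop :=
  ∃ (ξ : ℕ → Ω → Bool) (u : ℕ → Ω → ℕ) (T : ℕ → Ω → G → G) (g X : ℕ → Ω → G),
    IsDrivenBy P α μ ξ u T g X S

/-- Transience: almost surely the walk eventually leaves every finite set for good, that is,
it converges to infinity in the discrete space `G`. -/
def IsTransient {G : Type*} {Ω : Type*} [MeasurableSpace Ω]
    (P : Measure Ω) (S : ℕ → Ω → G) : Prop :=
  ∀ᵐ ω ∂P, Tendsto (fun n => S n ω) atTop cofinite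

/-- The number of vertices in the ball of radius `n` around the identity, for the graph distance
of the Cayley graph of `G` with respect to `Γ`. -/
noncomputable def ballCard {G : Type*} [Group G] (Γ : Set G) (n : ℕ) : ℕ :=
  {x : G | (SimpleGraph.mulCayley Γ).edist 1 x ≤ (n : ℕ∞)}.ncard

/-- The Cayley graph has polynomial growth of degree `d`: balls of radius `n` have `≍ n ^ d`
elements. -/
def HasPolynomialGrowth {G : Type*} [Group G] (Γ : Set G) (d : ℝ) : Prop :=
  ∃ c > (0 : ℝ), ∃ C > (0 : ℝ), ∀ n : ℕ, 1 ≤ n →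
    c * (n : ℝ) ^ d ≤ (ballCard Γ n : ℝ) ∧ (ballCard Γ n : ℝ) ≤ C * (n : ℝ) ^ d

/-- The Cayley graph has at least cubic growth. -/
def HasAtLeastCubicGrowth {G : Type*} [Group G] (Γ : Set G) : Prop :=
  ∃ c > (0 : ℝ), ∀ n : ℕ, 1 ≤ n → c * (n : ℝ) ^ 3 ≤ (ballCard Γ n : ℝ)

/-- The Cayley graph has exponential growth. -/
def HasExponentialGrowth {G : Type*} [Group G] (Γ : Set G) : Prop :=
  ∃ b > (1 : ℝ), ∀ᶠ n : ℕ in atTop, b ^ n ≤ (ballCard Γ n : ℝ)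

/-- The Cayley graph is nonamenable: the infimum of `|∂A| / |A|` over the nonempty finite sets `A`
of vertices is positive, where `∂A` is the set of edges leading from `A` to its complement. -/
def IsNonamenableCayley {G : Type*} [Group G] (Γ : Set G) : Prop :=
  0 < ⨅ A : {A : Finset G // A.Nonempty},
    (({e : G × G | (SimpleGraph.mulCayley Γ).Adj e.1 e.2 ∧ e.1 ∈ A.1 ∧ e.2 ∉ A.1}.ncard : ℝ) /
      (A.1.card : ℝ))

end SRRW

/-!
The transformations `T n` play no role beyond their independence of the fresh samples, because the
walk contains linearly many *isolated* steps: steps that use a fresh sample and are not repeated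
later. Among the last `w = δ n` steps about `(1 - α) w` are fresh, whereas a step of this window
repeats another one of the window only with probability about `δ`; for `δ` small compared with
`1 - α`, Hoeffding's inequality leaves at least `(1 - α) w / 4` isolated steps up to an
exponentially small probability (`IsDrivenBy.measure_isolatedSet_le`).

The fresh samples at isolated steps are independent of everything else, so that, given everything
else, the walk is a product of independent samples from `μ` and of constants
(`IsDrivenBy.measure_isolatedSet_inter_le`). Such a product is called a word here, with the samples
as its free letters. Its law, as a vector of `ℓ²(G)`, has its norm preserved by a constant letter,
since right translations are isometries. A free letter contracts it: laziness bounds the decrease of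
`‖ν‖²` from below by a multiple of `‖R_s ν - ν‖²` for every generator `s` (`exists_dissipation`).
This gradient is in turn bounded from below by the geometry of the Cayley graph, through the
pseudo-Poincaré inequality `‖ν‖² ≤ ‖ν‖ n max_s ‖R_s ν - ν‖ + 1 / |B(n)|` for a radius `n` such that
`|B(n)| ≥ 2 / ‖ν‖²` (`exists_contraction_of_ball`), or through Cheeger's inequality if the graph is
nonamenable (`exists_contraction_of_nonamenable`). In each of the three regimes a suitable function
of `‖ν‖²` grows linearly in the number of free letters. As the law of a word is the convolution of
the laws of its two halves, the Cauchy–Schwarz inequality turns the bounds for the norms into bounds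
for the largest atom (`wordLaw_singleton_le`). Transience follows from the bound `C n ^ (-3 / 2)` by
the Borel–Cantelli lemma.
-/

namespace SRRW

/-! ### Translations and mass functions in `ℓ²(G)` -/

/-- The real Hilbert space `ℓ²(G)`. -/
abbrev Ell2 (G : Type*) := lp (fun _ : G => ℝ) 2

section Ell2

variable {G : Type*}

theorem memEll2_iff {f : G → ℝ} : Memℓp f 2 ↔ Summable fun x => f x ^ 2 := by
  rw [memℓp_gen_iff (by norm_num)]
  simp

theorem Ell2.summable_sq (f : Ell2 G) : Summable fun x => f x ^ 2 :=
  memEll2_iff.1 (lp.memℓp f)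

theorem Ell2.norm_sq (f : Ell2 G) : ‖f‖ ^ 2 = ∑' x, f x ^ 2 := by
  have := lp.norm_rpow_eq_tsum (p := 2) (by norm_num) f
  simpa using this

theorem Ell2.inner_eq (f h : Ell2 G) : inner ℝ f h = ∑' x, f x * h x := by
  rw [lp.inner_eq_tsum]
  simp [mul_comm]

theorem Ell2.summable_mul (f h : Ell2 G) : Summable fun x => f x * h x := by
  have := lp.summable_inner (𝕜 := ℝ) f h
  simpa [mul_comm] using this

/-- Composition with a permutation of the index set, as an isometry of `ℓ²`. -/
noncomputable def Ell2.reindex (e : G ≃ G) : Ell2 G →ₗᵢ[ℝ] Ell2 G where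
  toFun f := ⟨fun x => f (e x), memEll2_iff.2 (e.summable_iff.2 (Ell2.summable_sq f))⟩
  map_add' f h := by ext x; rfl
  map_smul' c f := by ext x; rfl
  norm_map' f := by
    rw [← sq_eq_sq₀ (norm_nonneg _) (norm_nonneg _), Ell2.norm_sq, Ell2.norm_sq]
    exact e.tsum_eq fun x => f x ^ 2

theorem Ell2.reindex_apply (e : G ≃ G) (f : Ell2 G) (x : G) :
    Ell2.reindex e f x = f (e x) := rfl

section Translate

variable [Group G]

/-- Right translation on `ℓ²(G)`, `(R_y f)(x) = f(x y)`. -/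
noncomputable def rightTranslate (y : G) : Ell2 G →ₗᵢ[ℝ] Ell2 G :=
  Ell2.reindex (Equiv.mulRight y)

@[simp] theorem rightTranslate_apply (y : G) (f : Ell2 G) (x : G) :
    rightTranslate y f x = f (x * y) := rfl

theorem rightTranslate_mul (a b : G) (f : Ell2 G) :
    rightTranslate (a * b) f = rightTranslate a (rightTranslate b f) := by
  ext x; simp [mul_assoc]

@[simp] theorem rightTranslate_one (f : Ell2 G) : rightTranslate 1 f = f := by
  ext x; simp

theorem norm_rightTranslate_mul_sub (a s : G) (f : Ell2 G) :
    ‖rightTranslate (a * s) f - rightTranslate a f‖ = ‖rightTranslate s f - f‖ := by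
  rw [rightTranslate_mul, ← map_sub, LinearIsometry.norm_map]

theorem norm_rightTranslate_inv_sub (s : G) (f : Ell2 G) :
    ‖rightTranslate s⁻¹ f - f‖ = ‖rightTranslate s f - f‖ := by
  have := norm_rightTranslate_mul_sub s⁻¹ s f
  rw [inv_mul_cancel, rightTranslate_one] at this
  rw [← this, norm_sub_rev]

end Translate

theorem hasSum_real_singleton [MeasurableSpace G] [Countable G] [DiscreteMeasurableSpace G]
    (ν : Measure G) [IsProbabilityMeasure ν] :
    HasSum (fun x => ν.real {x}) 1 := by
  have h : ∑' x, ν {x} = 1 := by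
    have := lintegral_countable' (μ := ν) (fun _ => 1)
    simpa using this.symm
  have h2 := ENNReal.hasSum_toReal (f := fun x => ν {x}) (by simp [h])
  simpa [Measure.real, ← ENNReal.tsum_toReal_eq, h] using h2

theorem mass_sq_le [MeasurableSpace G] (ν : Measure G) [IsProbabilityMeasure ν] (x : G) :
    ν.real {x} ^ 2 ≤ ν.real {x} := by
  have h0 : 0 ≤ ν.real {x} := measureReal_nonneg
  have h1 : ν.real {x} ≤ 1 := measureReal_le_one
  nlinarith

variable [MeasurableSpace G] [Countable G] [DiscreteMeasurableSpace G]

/-- The mass function `x ↦ ν {x}` of a probability measure, as a vector of `ℓ²(G)`. -/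
noncomputable def massVec (ν : Measure G) [IsProbabilityMeasure ν] : Ell2 G :=
  ⟨fun x => ν.real {x}, memEll2_iff.2 <| Summable.of_nonneg_of_le (fun _ => sq_nonneg _)
    (mass_sq_le ν) (hasSum_real_singleton ν).summable⟩

@[simp] theorem massVec_apply (ν : Measure G) [IsProbabilityMeasure ν] (x : G) :
    massVec ν x = ν.real {x} := rfl

theorem norm_massVec_sq_le_one (ν : Measure G) [IsProbabilityMeasure ν] : ‖massVec ν‖ ^ 2 ≤ 1 := by
  rw [Ell2.norm_sq, ← (hasSum_real_singleton ν).tsum_eq]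
  exact (Ell2.summable_sq _).tsum_le_tsum (mass_sq_le ν) (hasSum_real_singleton ν).summable

theorem norm_massVec_pos (ν : Measure G) [IsProbabilityMeasure ν] : 0 < ‖massVec ν‖ := by
  rw [norm_pos_iff]
  intro h
  have h1 := hasSum_real_singleton ν
  have : (fun x => ν.real {x}) = fun _ => 0 := by
    funext x
    rw [← massVec_apply, h]; rfl
  rw [this] at h1
  exact zero_ne_one (hasSum_zero.unique h1)

variable [Group G]

theorem mconv_singleton (ν κ : Measure G) [IsProbabilityMeasure ν] [IsProbabilityMeasure κ]
    (x : G) : (ν ∗ₘ κ).real {x} = ∑' a, ν.real {a} * κ.real {a⁻¹ * x} := by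
  have h : (ν ∗ₘ κ) {x} = ∑' a, ν {a} * κ {a⁻¹ * x} := by
    rw [← lintegral_indicator_one (MeasurableSet.singleton x),
      Measure.lintegral_mconv (by fun_prop), lintegral_countable']
    refine tsum_congr fun a => ?_
    rw [mul_comm]
    congr 1
    rw [← lintegral_indicator_one (MeasurableSet.singleton (a⁻¹ * x))]
    refine lintegral_congr fun y => ?_
    have hy : a * y ∈ ({x} : Set G) ↔ y ∈ ({a⁻¹ * x} : Set G) := by
      simp [eq_inv_mul_iff_mul_eq]
    by_cases h : y ∈ ({a⁻¹ * x} : Set G)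
    · rw [Set.indicator_of_mem h, Set.indicator_of_mem (hy.2 h)]; rfl
    · rw [Set.indicator_of_notMem h, Set.indicator_of_notMem (mt hy.1 h)]
  rw [Measure.real, h, ENNReal.tsum_toReal_eq]
  · simp [Measure.real]
  · intro a
    exact ENNReal.mul_ne_top (measure_ne_top _ _) (measure_ne_top _ _)

/-- Cauchy–Schwarz: the largest atom of a convolution is bounded by the `ℓ²` norms. -/
theorem mconv_singleton_le (ν κ : Measure G) [IsProbabilityMeasure ν] [IsProbabilityMeasure κ]
    (x : G) : (ν ∗ₘ κ).real {x} ≤ ‖massVec ν‖ * ‖massVec κ‖ := by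
  let e : G ≃ G := (Equiv.inv G).trans (Equiv.mulRight x)
  have h := real_inner_le_norm (massVec ν) (Ell2.reindex e (massVec κ))
  rw [Ell2.inner_eq, LinearIsometry.norm_map] at h
  rw [mconv_singleton]
  simpa [Ell2.reindex_apply, e] using h

theorem massVec_mconv (ν κ : Measure G) [IsProbabilityMeasure ν] [IsProbabilityMeasure κ]
    (F : Finset G) (hF : ∀ x ∉ F, κ.real {x} = 0) :
    massVec (ν ∗ₘ κ) = ∑ s ∈ F, κ.real {s} • rightTranslate s⁻¹ (massVec ν) := by
  ext x
  rw [massVec_apply, mconv_singleton, lp.coeFn_sum, Finset.sum_apply]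
  let e : G ≃ G := (Equiv.inv G).trans (Equiv.mulLeft x)
  rw [← e.tsum_eq, tsum_eq_sum (s := F)]
  · refine Finset.sum_congr rfl fun s _ => ?_
    simp [e, mul_comm]
  · intro s hs
    simp [e, hF s hs]

theorem norm_massVec_mconv_dirac (ν : Measure G) [IsProbabilityMeasure ν] (c : G) :
    ‖massVec (ν ∗ₘ Measure.dirac c)‖ = ‖massVec ν‖ := by
  rw [massVec_mconv ν _ {c}]
  · simp [Measure.real]
  · intro x hx
    simp only [Finset.mem_singleton] at hx
    simp [Measure.real, Ne.symm hx]

end Ell2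

/-- A convex combination of vectors of norm `r` is shorter than `r` by an amount controlled by the
distance between any two of them. -/
theorem norm_sq_convexCombination_le {ι E : Type*} [NormedAddCommGroup E] [InnerProductSpace ℝ E]
    (F : Finset ι) (w : ι → ℝ) (hw : ∀ i ∈ F, 0 ≤ w i) (hsum : ∑ i ∈ F, w i = 1)
    (v : ι → E) (r : ℝ) (hv : ∀ i ∈ F, ‖v i‖ = r) {i j : ι} (hi : i ∈ F) (hj : j ∈ F) :
    ‖∑ k ∈ F, w k • v k‖ ^ 2 ≤ r ^ 2 - w i * w j * ‖v j - v i‖ ^ 2 := by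
  classical
  rcases eq_or_ne i j with rfl | hij
  · simp only [sub_self, norm_zero]
    have h1 : ‖∑ k ∈ F, w k • v k‖ ≤ r := by
      calc ‖∑ k ∈ F, w k • v k‖ ≤ ∑ k ∈ F, ‖w k • v k‖ := norm_sum_le _ _
        _ = ∑ k ∈ F, w k * r := Finset.sum_congr rfl fun k hk => by
          rw [norm_smul, hv k hk, Real.norm_of_nonneg (hw k hk)]
        _ = r := by rw [← Finset.sum_mul, hsum, one_mul]
    have := pow_le_pow_left₀ (norm_nonneg _) h1 2
    simpa using this
  -- polarization turns `‖∑ w k • v k‖ ^ 2` into `r ^ 2` minus half of the mean square distance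
  have hinner : ∀ k ∈ F, ∀ l ∈ F, inner ℝ (v k) (v l) = r ^ 2 - ‖v l - v k‖ ^ 2 / 2 := by
    intro k hk l hl
    rw [@norm_sub_sq ℝ, hv k hk, hv l hl]
    simp only [RCLike.re_to_real, real_inner_comm (v k)]
    ring
  have key : ‖∑ k ∈ F, w k • v k‖ ^ 2 =
      r ^ 2 - ∑ p ∈ F ×ˢ F, w p.1 * w p.2 * ‖v p.2 - v p.1‖ ^ 2 / 2 := by
    rw [← real_inner_self_eq_norm_sq, sum_inner]
    simp_rw [inner_sum, inner_smul_left, inner_smul_right]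
    rw [Finset.sum_product]
    have : r ^ 2 = ∑ k ∈ F, ∑ l ∈ F, w k * w l * r ^ 2 := by
      simp_rw [← Finset.sum_mul, ← Finset.mul_sum, hsum]; simp [hsum]
    conv_rhs => rw [this]
    rw [← Finset.sum_sub_distrib]
    refine Finset.sum_congr rfl fun k hk => ?_
    rw [← Finset.sum_sub_distrib]
    refine Finset.sum_congr rfl fun l hl => ?_
    rw [hinner k hk l hl]
    simp only [conj_trivial]
    ring
  rw [key]
  have h2 : ∑ p ∈ {(i, j), (j, i)}, w p.1 * w p.2 * ‖v p.2 - v p.1‖ ^ 2 / 2 ≤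
      ∑ p ∈ F ×ˢ F, w p.1 * w p.2 * ‖v p.2 - v p.1‖ ^ 2 / 2 := by
    refine Finset.sum_le_sum_of_subset_of_nonneg ?_ ?_
    · intro p hp
      simp only [Finset.mem_insert, Finset.mem_singleton] at hp
      rcases hp with rfl | rfl <;> simp [hi, hj]
    · rintro ⟨k, l⟩ hp -
      simp only [Finset.mem_product] at hp
      have := hw k hp.1
      have := hw l hp.2
      positivity
  rw [Finset.sum_pair (by simp [hij])] at h2
  rw [norm_sub_rev (v i)] at h2
  nlinarith

/-! ### One free step contracts the `ℓ²` norm -/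

theorem mem_stepSupport_iff {G : Type*} [MeasurableSpace G] (μ : Measure G)
    [IsProbabilityMeasure μ] (x : G) :
    x ∈ stepSupport μ ↔ 0 < μ.real {x} := by
  rw [stepSupport, Set.mem_ofPred_eq, Measure.real, ENNReal.toReal_pos_iff]
  simp

section Contraction

variable {G : Type*} [Group G]

/-- Laziness turns each generator into a dissipation term for the convolution with `μ`. -/
theorem exists_dissipation [Countable G] [MeasurableSpace G] [DiscreteMeasurableSpace G]
    (μ : Measure G) [IsProbabilityMeasure μ] (hone : 0 < μ.real {1})
    (hfin : (stepSupport μ).Finite) :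
    ∃ κ > (0 : ℝ), ∀ (ν : Measure G) [IsProbabilityMeasure ν], ∀ s ∈ stepSupport μ,
      ‖massVec (ν ∗ₘ μ)‖ ^ 2 ≤
        ‖massVec ν‖ ^ 2 - κ * ‖rightTranslate s (massVec ν) - massVec ν‖ ^ 2 := by
  set F := hfin.toFinset with hF
  have h1 : (1 : G) ∈ F := by simpa [hF, mem_stepSupport_iff] using hone
  have hzero : ∀ x ∉ F, μ.real {x} = 0 := by
    intro x hx
    simp only [hF, Set.Finite.mem_toFinset, mem_stepSupport_iff, not_lt] at hx
    exact le_antisymm hx measureReal_nonneg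
  obtain ⟨t, ht, hmin⟩ := F.exists_min_image (fun x => μ.real {x}) ⟨1, h1⟩
  have ht0 : 0 < μ.real {t} := by
    simpa [hF, mem_stepSupport_iff] using ht
  refine ⟨μ.real {1} * μ.real {t}, by positivity, fun ν _ s hs => ?_⟩
  have hsF : s ∈ F := by simpa [hF] using hs
  have hsum : ∑ x ∈ F, μ.real {x} = 1 := by
    rw [← (hasSum_real_singleton μ).tsum_eq, tsum_eq_sum hzero]
  have key := norm_sq_convexCombination_le F (fun x => μ.real {x})
    (fun _ _ => measureReal_nonneg) hsum (fun x => rightTranslate x⁻¹ (massVec ν))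
    ‖massVec ν‖ (fun _ _ => LinearIsometry.norm_map _ _) h1 hsF
  rw [← massVec_mconv ν μ F hzero] at key
  simp only [inv_one, rightTranslate_one, norm_rightTranslate_inv_sub] at key
  have h2 := mul_le_mul_of_nonneg_right (mul_le_mul_of_nonneg_left (hmin s hsF) hone.le)
    (sq_nonneg ‖rightTranslate s (massVec ν) - massVec ν‖)
  linarith

/-! ### Pseudo-Poincaré inequality on balls -/

theorem norm_rightTranslate_sub_le_of_walk (Γ : Set G) (f : Ell2 G) (D : ℝ)
    (hD : ∀ s ∈ Γ, ‖rightTranslate s f - f‖ ≤ D) {a b : G}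
    (p : (SimpleGraph.mulCayley Γ).Walk a b) :
    ‖rightTranslate b f - rightTranslate a f‖ ≤ p.length * D := by
  induction p with
  | nil => simp
  | @cons a b c hab p ih =>
    have hstep : ‖rightTranslate b f - rightTranslate a f‖ ≤ D := by
      obtain ⟨-, s, hs, rfl | rfl⟩ := (SimpleGraph.mulCayley_adj' Γ a b).1 hab
      · rw [norm_rightTranslate_mul_sub]; exact hD s hs
      · rw [norm_sub_rev, norm_rightTranslate_mul_sub]; exact hD s hs
    have := norm_sub_le_norm_sub_add_norm_sub (rightTranslate c f) (rightTranslate b f)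
      (rightTranslate a f)
    rw [SimpleGraph.Walk.length_cons]
    push_cast
    linarith

/-- Averaging `ν` over translations by the ball of radius `n` costs at most `n D` in norm, where `D`
bounds the increments along the generators, and leaves a function bounded by `1 / |B(n)|`. -/
theorem norm_sq_massVec_le_of_ball [Countable G] [MeasurableSpace G] [DiscreteMeasurableSpace G]
    (Γ : Set G) (ν : Measure G) [IsProbabilityMeasure ν] (D : ℝ)
    (hD0 : 0 ≤ D) (hD : ∀ s ∈ Γ, ‖rightTranslate s (massVec ν) - massVec ν‖ ≤ D) (n : ℕ)
    (hn : 0 < ballCard Γ n) :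
    ‖massVec ν‖ ^ 2 ≤ ‖massVec ν‖ * (n * D) + 1 / ballCard Γ n := by
  set B : Set G := {x : G | (SimpleGraph.mulCayley Γ).edist 1 x ≤ (n : ℕ∞)} with hB
  have hBfin : B.Finite := Set.finite_of_ncard_pos hn
  set F := hBfin.toFinset with hF
  have hcard : ballCard Γ n = F.card := Set.ncard_eq_toFinset_card B hBfin
  rw [hcard] at hn ⊢
  set v := massVec ν with hv
  have hclose : ∀ y ∈ F, ‖rightTranslate y v - v‖ ≤ n * D := by
    intro y hy
    have hy' : (SimpleGraph.mulCayley Γ).edist 1 y ≤ (n : ℕ∞) := by simpa [hF, hB] using hy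
    obtain ⟨p, hp⟩ := SimpleGraph.exists_walk_of_edist_ne_top
      (ne_top_of_le_ne_top (ENat.natCast_ne_top n) hy')
    have h1 := norm_rightTranslate_sub_le_of_walk Γ v D hD p
    rw [rightTranslate_one] at h1
    rw [← hp] at hy'
    have h2 : (p.length : ℝ) ≤ n := by exact_mod_cast hy'
    exact h1.trans (mul_le_mul_of_nonneg_right h2 hD0)
  have hpoint : ∀ y ∈ F, ‖v‖ ^ 2 ≤ ‖v‖ * (n * D) + inner ℝ v (rightTranslate y v) := by
    intro y hy
    have h1 := real_inner_le_norm v (v - rightTranslate y v)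
    rw [inner_sub_right, real_inner_self_eq_norm_sq, norm_sub_rev] at h1
    have h2 := mul_le_mul_of_nonneg_left (hclose y hy) (norm_nonneg v)
    linarith
  have hsum := Finset.sum_le_sum hpoint
  rw [Finset.sum_const, Finset.sum_add_distrib, Finset.sum_const] at hsum
  -- the translates of a point by the ball are distinct, so their total mass is at most one
  have hinner : ∑ y ∈ F, inner ℝ v (rightTranslate y v) ≤ 1 := by
    simp_rw [Ell2.inner_eq]
    rw [← Summable.tsum_finsetSum fun y _ => Ell2.summable_mul _ _,
      ← (hasSum_real_singleton ν).tsum_eq]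
    refine Summable.tsum_le_tsum (fun x => ?_)
      (summable_sum fun y _ => Ell2.summable_mul _ _) (hasSum_real_singleton ν).summable
    rw [← Finset.mul_sum]
    refine mul_le_of_le_one_right measureReal_nonneg ?_
    simp only [rightTranslate_apply, hv, massVec_apply]
    have h1 := (hasSum_real_singleton ν).summable.sum_le_tsum
      (F.map (Equiv.mulLeft x).toEmbedding) (fun _ _ => measureReal_nonneg)
    rw [Finset.sum_map, (hasSum_real_singleton ν).tsum_eq] at h1
    exact h1
  have hpos : (0 : ℝ) < F.card := by exact_mod_cast hn
  simp only [nsmul_eq_mul] at hsum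
  have h3 : (F.card : ℝ) * ‖v‖ ^ 2 ≤ F.card * (‖v‖ * (n * D)) + 1 := by linarith
  have h4 : ‖v‖ ^ 2 ≤ (F.card * (‖v‖ * (n * D)) + 1) / F.card := by
    rw [le_div_iff₀ hpos]; linarith
  rwa [add_div, mul_div_cancel_left₀ _ hpos.ne'] at h4

/-- If the ball of radius `n` has at least `2 / ‖ν‖²` elements, then one more free step reduces
`‖ν‖²` by a factor `exp (-κ / n²)`. -/
theorem exists_contraction_of_ball [Countable G] [MeasurableSpace G] [DiscreteMeasurableSpace G]
    (μ : Measure G) [IsProbabilityMeasure μ]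
    (hone : 0 < μ.real {1}) (hfin : (stepSupport μ).Finite) :
    ∃ κ > (0 : ℝ), ∀ (ν : Measure G) [IsProbabilityMeasure ν] (n : ℕ), 1 ≤ n →
      2 ≤ ‖massVec ν‖ ^ 2 * ballCard (stepSupport μ) n →
      ‖massVec (ν ∗ₘ μ)‖ ^ 2 ≤ ‖massVec ν‖ ^ 2 * Real.exp (-(κ / (n : ℝ) ^ 2)) := by
  obtain ⟨κ, hκ, hdiss⟩ := exists_dissipation μ hone hfin
  refine ⟨κ / 4, by positivity, fun ν _ n hn hball => ?_⟩
  obtain ⟨s, hs, hmax⟩ := Set.exists_max_image (stepSupport μ)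
    (fun s => ‖rightTranslate s (massVec ν) - massVec ν‖) hfin
    ⟨1, (mem_stepSupport_iff μ 1).2 hone⟩
  have h1 := hdiss ν s hs
  have hvpos := norm_massVec_pos ν
  have hV : 0 < ballCard (stepSupport μ) n := by
    rw [Nat.pos_iff_ne_zero]
    intro h
    rw [h] at hball
    norm_num at hball
  have h2 := norm_sq_massVec_le_of_ball (stepSupport μ) ν _ (norm_nonneg _) hmax n hV
  set a := ‖massVec ν‖
  set D := ‖rightTranslate s (massVec ν) - massVec ν‖
  have hV' : (0 : ℝ) < ballCard (stepSupport μ) n := by exact_mod_cast hV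
  have h3 : 1 / (ballCard (stepSupport μ) n : ℝ) ≤ a ^ 2 / 2 := by
    rw [div_le_div_iff₀ hV' two_pos]; linarith
  have hn' : (0 : ℝ) < n := by exact_mod_cast hn
  have h4 : a ≤ 2 * (n * D) := by
    have : a * a ≤ a * (2 * (n * D)) := by nlinarith
    exact le_of_mul_le_mul_left this hvpos
  have h5 : a ^ 2 / (4 * n ^ 2) ≤ D ^ 2 := by
    rw [div_le_iff₀ (by positivity)]
    calc a ^ 2 ≤ (2 * (n * D)) ^ 2 := pow_le_pow_left₀ hvpos.le h4 2
      _ = D ^ 2 * (4 * n ^ 2) := by ring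
  calc ‖massVec (ν ∗ₘ μ)‖ ^ 2 ≤ a ^ 2 - κ * D ^ 2 := h1
    _ ≤ a ^ 2 - κ * (a ^ 2 / (4 * n ^ 2)) := by gcongr
    _ = a ^ 2 * (-(κ / 4 / (n : ℝ) ^ 2) + 1) := by field_simp; ring
    _ ≤ _ := by gcongr; exact Real.add_one_le_exp _

/-! ### Cheeger's inequality -/

open Classical in
/-- The co-area inequality: an isoperimetric inequality for finite sets extends to nonnegative
finitely supported functions. The minimum over the support is peeled off, one level at a time. -/
theorem coarea_le (E : Finset G) (h : ℝ)
    (hiso : ∀ A : Finset G, A.Nonempty →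
      h * A.card ≤ ∑ s ∈ E, ∑ x ∈ A, if x * s ∈ A then (0 : ℝ) else 1) (A : Finset G) :
    ∀ g : G → ℝ, (∀ x, 0 ≤ g x) → (∀ x ∉ A, g x = 0) →
      h * ∑ x ∈ A, g x ≤ ∑ s ∈ E, ∑ x ∈ A, max (g x - g (x * s)) 0 := by
  induction A using Finset.strongInduction with
  | _ A ih =>
  intro g hg hA
  rcases A.eq_empty_or_nonempty with rfl | hne
  · simp
  obtain ⟨a, ha, hmin⟩ := A.exists_min_image g hne
  set g' : G → ℝ := fun x => if x ∈ A then g x - g a else 0 with hg'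
  have hg'0 : ∀ x, 0 ≤ g' x := by
    intro x
    by_cases hx : x ∈ A
    · simp [hg', hx, hmin x hx]
    · simp [hg', hx]
  have hga : g' a = 0 := by simp [hg']
  have h1 := ih (A.erase a) (Finset.erase_ssubset ha) g' hg'0 (by
    intro x hx
    by_cases hxa : x = a
    · rw [hxa, hga]
    · have : x ∉ A := fun h => hx (Finset.mem_erase.2 ⟨hxa, h⟩)
      simp [hg', this])
  rw [Finset.sum_erase _ hga] at h1
  have h2 : ∀ s, ∑ x ∈ A.erase a, max (g' x - g' (x * s)) 0 =
      ∑ x ∈ A, max (g' x - g' (x * s)) 0 := by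
    intro s
    apply Finset.sum_erase
    rw [hga]
    simpa using hg'0 (a * s)
  simp_rw [h2] at h1
  have h3 := mul_le_mul_of_nonneg_left (hiso A hne) (hg a)
  have h4 : ∑ s ∈ E, ∑ x ∈ A, max (g x - g (x * s)) 0 =
      ∑ s ∈ E, ∑ x ∈ A, max (g' x - g' (x * s)) 0 +
        g a * ∑ s ∈ E, ∑ x ∈ A, if x * s ∈ A then (0 : ℝ) else 1 := by
    simp_rw [Finset.mul_sum]
    rw [← Finset.sum_add_distrib]
    refine Finset.sum_congr rfl fun s _ => ?_
    rw [← Finset.sum_add_distrib]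
    refine Finset.sum_congr rfl fun x hx => ?_
    by_cases hxs : x * s ∈ A
    · simp [hg', hx, hxs]
    · have := hmin x hx
      simp [hg', hx, hxs, hA _ hxs, this, hg x]
  have h5 : ∑ x ∈ A, g x = ∑ x ∈ A, g' x + g a * A.card := by
    rw [mul_comm, ← nsmul_eq_mul, ← Finset.sum_const, ← Finset.sum_add_distrib]
    refine Finset.sum_congr rfl fun x hx => ?_
    simp [hg', hx]
  rw [h4, h5]
  nlinarith

open Classical in
/-- The isoperimetric inequality, counting boundary edges as pairs of a generator or its inverse and
a vertex. -/
theorem exists_isoperimetry_of_nonamenable {Γ : Set G} (hΓ : Γ.Finite)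
    (h : IsNonamenableCayley Γ) :
    ∃ h > (0 : ℝ), ∀ A : Finset G, A.Nonempty →
      h * A.card ≤ ∑ s ∈ hΓ.toFinset ∪ hΓ.toFinset.image (·⁻¹), ∑ x ∈ A,
        if x * s ∈ A then (0 : ℝ) else 1 := by
  refine ⟨_, h, fun A hA => ?_⟩
  set E := hΓ.toFinset ∪ hΓ.toFinset.image (·⁻¹) with hE
  have hpos : (0 : ℝ) < A.card := by exact_mod_cast hA.card_pos
  have h1 := ciInf_le (f := fun A : {A : Finset G // A.Nonempty} =>
    (({e : G × G | (SimpleGraph.mulCayley Γ).Adj e.1 e.2 ∧ e.1 ∈ A.1 ∧ e.2 ∉ A.1}.ncard : ℝ) /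
      (A.1.card : ℝ))) ⟨0, by rintro _ ⟨A, rfl⟩; positivity⟩ ⟨A, hA⟩
  rw [le_div_iff₀ hpos] at h1
  refine h1.trans ?_
  set P : Finset (G × G) := (E ×ˢ A).filter fun p => p.2 * p.1 ∉ A
  have hP : ∑ s ∈ E, ∑ x ∈ A, (if x * s ∈ A then (0 : ℝ) else 1) = P.card := by
    rw [← Finset.sum_product', Finset.card_filter]
    push_cast
    refine Finset.sum_congr rfl fun p _ => ?_
    by_cases hp : p.2 * p.1 ∈ A <;> simp [hp]
  rw [hP]
  have hsub : {e : G × G | (SimpleGraph.mulCayley Γ).Adj e.1 e.2 ∧ e.1 ∈ A ∧ e.2 ∉ A} ⊆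
      ((P.image fun p => (p.2, p.2 * p.1) : Finset (G × G)) : Set (G × G)) := by
    rintro ⟨x, y⟩ ⟨hadj, hx, hy⟩
    simp only [Finset.coe_image, Set.mem_image, Finset.mem_coe]
    obtain ⟨-, s, hs, hxy⟩ := (SimpleGraph.mulCayley_adj' Γ x y).1 hadj
    refine ⟨(x⁻¹ * y, x), ?_, by simp⟩
    simp only [P, Finset.mem_filter, Finset.mem_product, hE, Finset.mem_union, Finset.mem_image,
      Set.Finite.mem_toFinset]
    refine ⟨⟨?_, hx⟩, by simpa using hy⟩
    rcases hxy with hxy | hxy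
    · left
      have hxy' : x * s = y := hxy
      rw [← hxy', inv_mul_cancel_left]; exact hs
    · right
      have hxy' : x = y * s := hxy
      exact ⟨s, hs, by rw [hxy']; group⟩
  have h2 := Set.ncard_le_ncard hsub (Finset.finite_toSet _)
  rw [Set.ncard_coe_finset] at h2
  exact_mod_cast h2.trans Finset.card_image_le

/-- The total variation of `v ^ 2` in the direction `s`, bounded by factoring
`v x ^ 2 - v (x s) ^ 2` and the Cauchy–Schwarz inequality. -/
theorem sum_max_sq_sub_le (v : Ell2 G) (A : Finset G) (s : G) :
    ∑ x ∈ A, max (v x ^ 2 - v (x * s) ^ 2) 0 ≤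
      2 * ‖v‖ * ‖rightTranslate s v - v‖ := by
  have hbound : ∀ f : Ell2 G, √(∑ x ∈ A, |f x| ^ 2) ≤ ‖f‖ := by
    intro f
    rw [Real.sqrt_le_left (norm_nonneg _), Ell2.norm_sq]
    simp_rw [sq_abs]
    exact (Ell2.summable_sq f).sum_le_tsum _ (fun _ _ => sq_nonneg _)
  have h1 : ∀ x ∈ A, max (v x ^ 2 - v (x * s) ^ 2) 0 ≤
      |(rightTranslate s v - v) x| * |(rightTranslate s v + v) x| := by
    intro x _
    rw [← abs_mul]
    refine max_le ?_ (abs_nonneg _)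
    refine le_trans (le_of_eq ?_) (neg_le_abs _)
    simp only [lp.coeFn_sub, lp.coeFn_add, Pi.sub_apply, Pi.add_apply, rightTranslate_apply]
    ring
  refine (Finset.sum_le_sum h1).trans ((Real.sum_mul_le_sqrt_mul_sqrt _ _ _).trans ?_)
  rw [mul_comm]
  refine mul_le_mul ?_ (hbound _) (Real.sqrt_nonneg _) (by positivity)
  refine (hbound _).trans ((norm_add_le _ _).trans ?_)
  rw [LinearIsometry.norm_map]; linarith

open Classical in
/-- Cheeger's inequality: an isoperimetric inequality gives a spectral gap on all of `ℓ²(G)`. -/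
theorem cheeger_le (E : Finset G) (h : ℝ)
    (hiso : ∀ A : Finset G, A.Nonempty →
      h * A.card ≤ ∑ s ∈ E, ∑ x ∈ A, if x * s ∈ A then (0 : ℝ) else 1) (v : Ell2 G) :
    h * ‖v‖ ≤ 2 * ∑ s ∈ E, ‖rightTranslate s v - v‖ := by
  have hfinite : ∀ (A : Finset G) (f : Ell2 G), (∀ x ∉ A, f x = 0) →
      h * ‖f‖ ≤ 2 * ∑ s ∈ E, ‖rightTranslate s f - f‖ := by
    intro A f hA
    have h1 := coarea_le E h hiso A (fun x => f x ^ 2) (fun _ => sq_nonneg _)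
      (fun x hx => by simp [hA x hx])
    have h2 : ∑ x ∈ A, f x ^ 2 = ‖f‖ ^ 2 := by
      rw [Ell2.norm_sq, tsum_eq_sum fun x hx => by simp [hA x hx]]
    have h3 := h1.trans (Finset.sum_le_sum fun s _ => sum_max_sq_sub_le f A s)
    rw [h2, ← Finset.mul_sum] at h3
    rcases (norm_nonneg f).eq_or_lt with h0 | h0
    · rw [← h0, mul_zero]; positivity
    · refine le_of_mul_le_mul_left ?_ h0
      linarith
  -- both sides are continuous in `v`, and finitely supported vectors are dense
  have hlim := lp.hasSum_single (p := 2) (by norm_num) v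
  have hcont : Continuous fun f : Ell2 G => 2 * ∑ s ∈ E, ‖rightTranslate s f - f‖ := by
    fun_prop
  have hcont' : Continuous fun f : Ell2 G => h * ‖f‖ := by fun_prop
  refine le_of_tendsto_of_tendsto ((hcont'.tendsto v).comp hlim) ((hcont.tendsto v).comp hlim)
    (Eventually.of_forall fun A => hfinite A _ fun x hx => ?_)
  rw [lp.coeFn_sum, Finset.sum_apply]
  refine Finset.sum_eq_zero fun y hy => ?_
  rw [lp.single_apply_ne]
  rintro rfl
  exact hx hy

/-- In a nonamenable Cayley graph a free step reduces `‖ν‖²` by a constant factor. -/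
theorem exists_contraction_of_nonamenable [Countable G] [MeasurableSpace G]
    [DiscreteMeasurableSpace G] (μ : Measure G) [IsProbabilityMeasure μ]
    (hone : 0 < μ.real {1}) (hfin : (stepSupport μ).Finite)
    (hna : IsNonamenableCayley (stepSupport μ)) :
    ∃ κ > (0 : ℝ), ∀ (ν : Measure G) [IsProbabilityMeasure ν],
      ‖massVec (ν ∗ₘ μ)‖ ^ 2 ≤ ‖massVec ν‖ ^ 2 * Real.exp (-κ) := by
  classical
  obtain ⟨κ, hκ, hdiss⟩ := exists_dissipation μ hone hfin
  obtain ⟨h, hh, hiso⟩ := exists_isoperimetry_of_nonamenable hfin hna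
  set E := hfin.toFinset ∪ hfin.toFinset.image (·⁻¹) with hE
  have h1F : (1 : G) ∈ stepSupport μ := (mem_stepSupport_iff μ 1).2 hone
  have hEpos : (0 : ℝ) < E.card := by
    have : (1 : G) ∈ E := by simp [hE, h1F]
    exact_mod_cast Finset.card_pos.2 ⟨1, this⟩
  refine ⟨κ * (h / (2 * E.card)) ^ 2, by positivity, fun ν _ => ?_⟩
  obtain ⟨s, hs, hmax⟩ := Set.exists_max_image (stepSupport μ)
    (fun s => ‖rightTranslate s (massVec ν) - massVec ν‖) hfin ⟨1, h1F⟩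
  have h1 := hdiss ν s hs
  have h2 := cheeger_le E h hiso (massVec ν)
  have h3 : ∑ t ∈ E, ‖rightTranslate t (massVec ν) - massVec ν‖ ≤
      E.card * ‖rightTranslate s (massVec ν) - massVec ν‖ := by
    rw [← nsmul_eq_mul]
    refine Finset.sum_le_card_nsmul _ _ _ fun t ht => ?_
    simp only [hE, Finset.mem_union, Set.Finite.mem_toFinset, Finset.mem_image] at ht
    rcases ht with ht | ⟨t, ht, rfl⟩
    · exact hmax t ht
    · rw [norm_rightTranslate_inv_sub]; exact hmax t ht
  set a := ‖massVec ν‖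
  set D := ‖rightTranslate s (massVec ν) - massVec ν‖
  have h4 : h / (2 * E.card) * a ≤ D := by
    rw [div_mul_eq_mul_div, div_le_iff₀ (by positivity)]
    linarith
  have h5 := pow_le_pow_left₀ (by positivity) h4 2
  rw [mul_pow] at h5
  calc ‖massVec (ν ∗ₘ μ)‖ ^ 2 ≤ a ^ 2 - κ * D ^ 2 := h1
    _ ≤ a ^ 2 - κ * ((h / (2 * E.card)) ^ 2 * a ^ 2) := by gcongr
    _ = a ^ 2 * (-(κ * (h / (2 * E.card)) ^ 2) + 1) := by ring
    _ ≤ _ := by gcongr; exact Real.add_one_le_exp _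

end Contraction

/-! ### Laws of words with free and prescribed letters -/

/-- The number of free letters among the first `n` letters of a word. -/
def freeCount {α : Type*} (l : ℕ → Option α) (n : ℕ) : ℕ :=
  Nat.count (fun j => (l j).isNone = true) n

theorem exists_freeCount_eq {α : Type*} (l : ℕ → Option α) {k n : ℕ} (h : k ≤ freeCount l n) :
    ∃ a ≤ n, freeCount l a = k := by
  induction n with
  | zero => exact ⟨0, le_rfl, by simp [freeCount] at h ⊢; exact h.symm⟩
  | succ n ih =>
    rcases h.eq_or_lt with h | h
    · exact ⟨n + 1, le_rfl, h.symm⟩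
    · have h1 : freeCount l (n + 1) ≤ freeCount l n + 1 := by
        simp only [freeCount, Nat.count_succ]; split_ifs <;> omega
      obtain ⟨a, ha, h2⟩ := ih (by omega)
      exact ⟨a, by omega, h2⟩

section Words

variable {G : Type*} [Group G] [MeasurableSpace G]

/-- The law of a letter: a free letter `none` is a sample from `μ`, a prescribed letter `some c` is
the constant `c`. -/
noncomputable def letterLaw (μ : Measure G) : Option G → Measure G
  | none => μ
  | some c => Measure.dirac c

/-- The law of the product of the first `n` letters of a word, the free letters being
independent. -/
noncomputable def wordLaw (μ : Measure G) (l : ℕ → Option G) : ℕ → Measure G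
  | 0 => Measure.dirac 1
  | n + 1 => wordLaw μ l n ∗ₘ letterLaw μ (l n)

variable [Countable G] [DiscreteMeasurableSpace G] (μ : Measure G)

theorem wordLaw_add (l : ℕ → Option G) (a b : ℕ) :
    wordLaw μ l (a + b) = wordLaw μ l a ∗ₘ wordLaw μ (fun k => l (a + k)) b := by
  induction b with
  | zero => simp [wordLaw]
  | succ b ih => rw [← add_assoc, wordLaw, wordLaw, ih, Measure.mconv_assoc]

variable [IsProbabilityMeasure μ]

instance (o : Option G) : IsProbabilityMeasure (letterLaw μ o) := by
  cases o <;> simp only [letterLaw] <;> infer_instance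

instance (l : ℕ → Option G) (n : ℕ) : IsProbabilityMeasure (wordLaw μ l n) := by
  induction n with
  | zero => simp only [wordLaw]; infer_instance
  | succ n ih => simp only [wordLaw]; infer_instance

/-- A word with `2 k` free letters splits into two words with `k` free letters, and the largest
atom of a convolution is at most the product of the two `ℓ²` norms. -/
theorem wordLaw_singleton_le (k : ℕ) (r : ℝ)
    (hr : ∀ (l : ℕ → Option G) (n : ℕ), k ≤ freeCount l n → ‖massVec (wordLaw μ l n)‖ ^ 2 ≤ r)
    (l : ℕ → Option G) (n : ℕ) (hk : 2 * k ≤ freeCount l n) (x : G) :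
    (wordLaw μ l n).real {x} ≤ r := by
  obtain ⟨a, han, ha⟩ := exists_freeCount_eq l (k := k) (by omega : k ≤ freeCount l n)
  obtain ⟨b, rfl⟩ := Nat.exists_eq_add_of_le han
  have hb : k ≤ freeCount (fun j => l (a + j)) b := by
    have : freeCount l (a + b) = freeCount l a + freeCount (fun j => l (a + j)) b :=
      Nat.count_add _ _ _
    omega
  have h1 := hr l a ha.ge
  have h2 := hr _ b hb
  have h3 := mconv_singleton_le (wordLaw μ l a) (wordLaw μ (fun j => l (a + j)) b) x
  simp only [wordLaw_add]
  nlinarith [sq_nonneg (‖massVec (wordLaw μ l a)‖ - ‖massVec (wordLaw μ (fun j => l (a + j)) b)‖)]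

theorem norm_massVec_dirac_one : ‖massVec (Measure.dirac (1 : G))‖ ^ 2 = 1 := by
  rw [Ell2.norm_sq, tsum_eq_single 1]
  · simp [Measure.real]
  · intro x hx
    simp [Measure.real, hx.symm]

/-- If each free step raises a potential `H (‖ν‖²)` by `δ`, then the potential of a word is at least
`δ` times its number of free letters; prescribed letters do not change `‖ν‖²`. -/
theorem mul_freeCount_le_potential (H : ℝ → ℝ) (δ : ℝ) (hH1 : 0 ≤ H 1)
    (hH : ∀ (ν : Measure G) [IsProbabilityMeasure ν],
      H (‖massVec ν‖ ^ 2) + δ ≤ H (‖massVec (ν ∗ₘ μ)‖ ^ 2)) (l : ℕ → Option G) (n : ℕ) :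
    δ * freeCount l n ≤ H (‖massVec (wordLaw μ l n)‖ ^ 2) := by
  have hstep : ∀ (ν : Measure G) [IsProbabilityMeasure ν] (o : Option G),
      H (‖massVec ν‖ ^ 2) + δ * (if o.isNone then 1 else 0 : ℕ) ≤
        H (‖massVec (ν ∗ₘ letterLaw μ o)‖ ^ 2) := by
    rintro ν _ (_ | c)
    · simpa [letterLaw] using hH ν
    · simp [letterLaw, norm_massVec_mconv_dirac]
  induction n with
  | zero => simpa [freeCount, wordLaw, norm_massVec_dirac_one] using hH1
  | succ n ih =>
    have hcount : freeCount l (n + 1) = freeCount l n + if (l n).isNone then 1 else 0 :=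
      Nat.count_succ _ _
    have := hstep (wordLaw μ l n) (l n)
    rw [hcount, Nat.cast_add, mul_add]
    simp only [wordLaw]
    linarith

end Words

/-! ### Heat kernel bounds for words -/

section Decay

variable {G : Type*} [Group G] [MeasurableSpace G] [Countable G] [DiscreteMeasurableSpace G]
  (μ : Measure G) [IsProbabilityMeasure μ]

/-- The potential is `-log u`. -/
theorem wordLaw_le_of_nonamenable (hone : 0 < μ.real {1}) (hfin : (stepSupport μ).Finite)
    (hna : IsNonamenableCayley (stepSupport μ)) :
    ∃ δ > (0 : ℝ), ∀ (l : ℕ → Option G) (n k : ℕ), 2 * k ≤ freeCount l n → ∀ x,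
      (wordLaw μ l n).real {x} ≤ Real.exp (-(δ * k)) := by
  obtain ⟨κ, hκ, hcon⟩ := exists_contraction_of_nonamenable μ hone hfin hna
  refine ⟨κ, hκ, fun l n k hk x => wordLaw_singleton_le μ k _ (fun l n hk => ?_) l n hk x⟩
  have hpot := mul_freeCount_le_potential μ (fun u => -Real.log u) κ (by simp) (fun ν _ => by
    have h1 := Real.log_le_log (pow_pos (norm_massVec_pos _) 2) (hcon ν)
    rw [Real.log_mul (pow_pos (norm_massVec_pos _) 2).ne' (Real.exp_ne_zero _),
      Real.log_exp] at h1
    linarith) l n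
  have hk' : κ * k ≤ κ * freeCount l n := by gcongr
  rw [← Real.log_le_iff_le_exp (pow_pos (norm_massVec_pos _) 2)]
  linarith

/-- The potential is `(K - log u) ^ 3`: a free step raises `-log u` by at least a multiple of
`(K - log u)⁻²`. -/
theorem wordLaw_le_of_exponentialGrowth (hone : 0 < μ.real {1}) (hfin : (stepSupport μ).Finite)
    (hexp : HasExponentialGrowth (stepSupport μ)) :
    ∃ δ > (0 : ℝ), ∃ K : ℝ, ∀ (l : ℕ → Option G) (n k : ℕ), 2 * k ≤ freeCount l n → ∀ x,
      (wordLaw μ l n).real {x} ≤ Real.exp (K - (δ * k) ^ (1 / 3 : ℝ)) := by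
  obtain ⟨κ, hκ, hcon⟩ := exists_contraction_of_ball μ hone hfin
  obtain ⟨b, hb, hgrow⟩ := hexp
  obtain ⟨N, hN⟩ := eventually_atTop.1 hgrow
  have hlb : 0 < Real.log b := Real.log_pos hb
  set K := Real.log 2 + (N + 2) * Real.log b with hK
  have hKpos : 0 < K := by
    have := Real.log_pos one_lt_two
    positivity
  refine ⟨3 * κ * Real.log b ^ 2, by positivity, K,
    fun l n k hk x => wordLaw_singleton_le μ k _ (fun l n hk => ?_) l n hk x⟩
  have hpot := mul_freeCount_le_potential μ (fun u => (K - Real.log u) ^ 3)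
    (3 * κ * Real.log b ^ 2) (by simp; positivity) (fun ν _ => by
      have hu0 := pow_pos (norm_massVec_pos ν) 2
      have hu1 := norm_massVec_sq_le_one ν
      set u := ‖massVec ν‖ ^ 2 with hu
      have hlu : Real.log u ≤ 0 := Real.log_nonpos hu0.le hu1
      -- a radius, logarithmic in `1 / u`, whose ball has at least `2 / u` elements
      set r := N + 1 + ⌈Real.log (2 / u) / Real.log b⌉₊ with hr
      have hq : 0 ≤ Real.log (2 / u) / Real.log b := by
        refine div_nonneg (Real.log_nonneg ?_) hlb.le
        rw [le_div_iff₀ hu0]; linarith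
      have hlow : 2 / u ≤ b ^ r := by
        rw [← Real.log_le_log_iff (by positivity) (by positivity), Real.log_pow,
          ← div_le_iff₀ hlb]
        refine (Nat.le_ceil _).trans ?_
        rw [hr]; push_cast
        have : (0 : ℝ) ≤ N := Nat.cast_nonneg _
        linarith
      have hup : r * Real.log b ≤ K - Real.log u := by
        have h1 := (Nat.ceil_lt_add_one hq).le
        have h2 : Real.log (2 / u) / Real.log b * Real.log b = Real.log 2 - Real.log u := by
          rw [div_mul_cancel₀ _ hlb.ne', Real.log_div two_ne_zero hu0.ne']
        have h3 := mul_le_mul_of_nonneg_right h1 hlb.le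
        rw [hr, hK]; push_cast
        nlinarith
      have hball : 2 ≤ u * ballCard (stepSupport μ) r := by
        have := hlow.trans (hN r (by omega))
        rw [div_le_iff₀ hu0] at this
        linarith
      have hr1 : 1 ≤ r := by omega
      have hrpos : (0 : ℝ) < r := by exact_mod_cast hr1
      have h1 := Real.log_le_log (pow_pos (norm_massVec_pos _) 2) (hcon ν r hr1 hball)
      rw [Real.log_mul hu0.ne' (Real.exp_ne_zero _), Real.log_exp] at h1
      set L := K - Real.log u with hL
      have hLpos : 0 < L := by linarith
      have h2 : κ * Real.log b ^ 2 / L ^ 2 ≤ κ / (r : ℝ) ^ 2 := by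
        rw [div_le_div_iff₀ (by positivity) (by positivity), mul_assoc]
        refine mul_le_mul_of_nonneg_left ?_ hκ.le
        rw [← mul_pow, mul_comm]
        exact pow_le_pow_left₀ (by positivity) hup 2
      set g := κ * Real.log b ^ 2 / L ^ 2 with hg
      have hgpos : 0 < g := by positivity
      have h3 : L + g ≤ K - Real.log (‖massVec (ν ∗ₘ μ)‖ ^ 2) := by linarith
      have h4 := pow_le_pow_left₀ (by positivity) h3 3
      have h5 : L ^ 2 * g = κ * Real.log b ^ 2 := by rw [hg]; field_simp
      calc L ^ 3 + 3 * κ * Real.log b ^ 2 = L ^ 3 + 3 * (L ^ 2 * g) := by rw [h5]; ring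
        _ ≤ (L + g) ^ 3 := by
          have : 0 ≤ 3 * L * g ^ 2 + g ^ 3 := by positivity
          nlinarith
        _ ≤ _ := h4) l n
  have hu0 := pow_pos (norm_massVec_pos (wordLaw μ l n)) 2
  have hlu := Real.log_nonpos hu0.le (norm_massVec_sq_le_one (wordLaw μ l n))
  set u := ‖massVec (wordLaw μ l n)‖ ^ 2
  rw [← Real.log_le_iff_le_exp hu0]
  have h1 : 3 * κ * Real.log b ^ 2 * k ≤ (K - Real.log u) ^ 3 :=
    le_trans (by gcongr) hpot
  have h2 := Real.rpow_le_rpow (by positivity) h1 (by norm_num : (0 : ℝ) ≤ 1 / 3)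
  rw [← Real.rpow_natCast (K - Real.log u) 3, ← Real.rpow_mul (by linarith)] at h2
  norm_num at h2
  norm_num
  linarith

/-- The potential is `u ^ (-2 / d)`: a free step multiplies `u` by `exp (-c u ^ (2 / d))`. Only the
lower bound on the growth matters. -/
theorem wordLaw_le_of_polynomialGrowth (hone : 0 < μ.real {1}) (hfin : (stepSupport μ).Finite)
    {d : ℝ} (hd : 0 < d) {c : ℝ} (hc : 0 < c)
    (hpoly : ∀ n : ℕ, 1 ≤ n → c * (n : ℝ) ^ d ≤ ballCard (stepSupport μ) n) :
    ∃ δ > (0 : ℝ), ∀ (l : ℕ → Option G) (n k : ℕ), 1 ≤ k → 2 * k ≤ freeCount l n → ∀ x,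
      (wordLaw μ l n).real {x} ≤ (δ * k) ^ (-(d / 2)) := by
  obtain ⟨κ, hκ, hcon⟩ := exists_contraction_of_ball μ hone hfin
  set c' := min c 1 with hc'
  have hc'0 : 0 < c' := lt_min hc one_pos
  set δ := 2 / d * (κ / (4 * (2 / c') ^ (2 / d))) with hδ
  have hδ0 : 0 < δ := by positivity
  refine ⟨δ, hδ0, fun l n k hk1 hk x => wordLaw_singleton_le μ k _ (fun l n hk => ?_) l n hk x⟩
  have hpot := mul_freeCount_le_potential μ (fun u => u ^ (-(2 / d))) δ (by simp) (fun ν _ => by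
    have hu0 := pow_pos (norm_massVec_pos ν) 2
    have hu1 := norm_massVec_sq_le_one ν
    set u := ‖massVec ν‖ ^ 2 with hu
    -- `n` is the integer radius just above `t`, at which the lower bound for the ball is `2 / u`
    set t := (2 / (c' * u)) ^ (1 / d) with ht
    have hbase : 1 ≤ 2 / (c' * u) := by
      rw [le_div_iff₀ (by positivity)]
      have : c' * u ≤ 1 * 1 := mul_le_mul (min_le_right _ _) hu1 hu0.le zero_le_one
      linarith
    have ht1 : 1 ≤ t := Real.one_le_rpow hbase (by positivity)
    have htd : t ^ d = 2 / (c' * u) := by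
      rw [ht, ← Real.rpow_mul (by positivity), one_div, inv_mul_cancel₀ hd.ne', Real.rpow_one]
    have ht2 : t ^ 2 = (2 / c') ^ (2 / d) * u ^ (-(2 / d)) := by
      rw [ht, ← Real.rpow_natCast, ← Real.rpow_mul (by positivity), ← div_div,
        div_eq_mul_inv (2 / c') u, Real.mul_rpow (by positivity) (by positivity),
        Real.inv_rpow hu0.le, ← Real.rpow_neg hu0.le]
      norm_num [div_eq_mul_inv, mul_comm]
    set n := ⌈t⌉₊ with hn
    have hn_ge : t ≤ n := Nat.le_ceil t
    have hn_le : (n : ℝ) ≤ 2 * t := by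
      have := (Nat.ceil_lt_add_one (by linarith : 0 ≤ t)).le
      linarith
    have hn1 : 1 ≤ n := by
      have : (1 : ℝ) ≤ n := ht1.trans hn_ge
      exact_mod_cast this
    have hnpos : (0 : ℝ) < n := by exact_mod_cast hn1
    have hball : 2 ≤ u * ballCard (stepSupport μ) n := by
      have h1 : c' * t ^ d ≤ ballCard (stepSupport μ) n := by
        refine le_trans ?_ (hpoly n hn1)
        exact mul_le_mul (min_le_left _ _)
          (Real.rpow_le_rpow (by linarith) hn_ge hd.le) (by positivity) hc.le
      have h2 := mul_le_mul_of_nonneg_left h1 hu0.le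
      rw [htd] at h2
      refine le_trans (le_of_eq ?_) h2
      field_simp
    have h1 := hcon ν n hn1 hball
    have h2 : κ / (4 * (2 / c') ^ (2 / d)) * u ^ (2 / d) ≤ κ / (n : ℝ) ^ 2 := by
      have h3 : (n : ℝ) ^ 2 ≤ 4 * ((2 / c') ^ (2 / d) * u ^ (-(2 / d))) := by
        rw [← ht2]
        calc (n : ℝ) ^ 2 ≤ (2 * t) ^ 2 := pow_le_pow_left₀ hnpos.le hn_le 2
          _ = 4 * t ^ 2 := by ring
      refine le_trans (le_of_eq ?_) (div_le_div_of_nonneg_left hκ.le (by positivity) h3)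
      rw [Real.rpow_neg hu0.le]
      have := Real.rpow_pos_of_pos hu0 (2 / d)
      field_simp
    have h3 : ‖massVec (ν ∗ₘ μ)‖ ^ 2 ≤
        u * Real.exp (-(κ / (4 * (2 / c') ^ (2 / d)) * u ^ (2 / d))) :=
      h1.trans (by gcongr)
    have h4 := Real.rpow_le_rpow_of_nonpos (pow_pos (norm_massVec_pos (ν ∗ₘ μ)) 2) h3
      (by simp only [Left.neg_nonpos_iff]; positivity : -(2 / d) ≤ 0)
    refine le_trans ?_ h4
    rw [Real.mul_rpow hu0.le (Real.exp_pos _).le, ← Real.exp_mul]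
    have h5 := Real.add_one_le_exp
      (-(κ / (4 * (2 / c') ^ (2 / d)) * u ^ (2 / d)) * -(2 / d))
    have h6 := mul_le_mul_of_nonneg_left h5 (Real.rpow_nonneg hu0.le (-(2 / d)))
    refine le_trans (le_of_eq ?_) h6
    have h7 : u ^ (-(2 / d)) * u ^ (2 / d) = 1 := by
      rw [← Real.rpow_add hu0]; simp
    rw [hδ]
    linear_combination (-(κ / (4 * (2 / c') ^ (2 / d))) * (2 / d)) * h7) l n
  have hu0 := pow_pos (norm_massVec_pos (wordLaw μ l n)) 2
  set u := ‖massVec (wordLaw μ l n)‖ ^ 2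
  have hk0 : (0 : ℝ) < k := by exact_mod_cast hk1
  have h1 : δ * k ≤ u ^ (-(2 / d)) := le_trans (by gcongr) hpot
  have h2 := Real.rpow_le_rpow_of_nonpos (by positivity) h1
    (by simp only [Left.neg_nonpos_iff]; positivity : -(d / 2) ≤ 0)
  rw [← Real.rpow_mul hu0.le] at h2
  have h3 : -(2 / d) * -(d / 2) = 1 := by field_simp
  rwa [h3, Real.rpow_one] at h2

end Decay

/-! ### Products of independent letters -/

/-- The product `y 0 * ⋯ * y (n - 1)` in a possibly noncommutative group. -/
def partialProd {G : Type*} [Group G] (y : ℕ → G) : ℕ → G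
  | 0 => 1
  | n + 1 => partialProd y n * y n

theorem partialProd_congr {G : Type*} [Group G] {y z : ℕ → G} {n : ℕ}
    (h : ∀ j < n, y j = z j) : partialProd y n = partialProd z n := by
  induction n with
  | zero => rfl
  | succ n ih =>
    simp only [partialProd]
    rw [ih fun j hj => h j (by omega), h n (by omega)]

theorem measurable_partialProd {G Ω : Type*} [Group G] [MeasurableSpace G] [MeasurableMul₂ G]
    {m : MeasurableSpace Ω} {y : ℕ → Ω → G} {n : ℕ} (hy : ∀ j < n, Measurable (y j)) :
    Measurable fun ω => partialProd (fun j => y j ω) n := by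
  induction n with
  | zero => exact measurable_const
  | succ n ih => exact (ih fun j hj => hy j (by omega)).mul (hy n (by omega))

/-- If `m₁` is independent of `m₂ ⊔ m₃` and `m₂` of `m₃`, then `m₁ ⊔ m₂` is independent of `m₃`. -/
theorem indep_sup_left {Ω : Type*} {mΩ : MeasurableSpace Ω} {P : Measure Ω}
    [IsZeroOrProbabilityMeasure P] {m₁ m₂ m₃ : MeasurableSpace Ω}
    (h₁ : m₁ ≤ mΩ) (h₂ : m₂ ≤ mΩ) (h₃ : m₃ ≤ mΩ)
    (h : Indep m₁ (m₂ ⊔ m₃) P) (h' : Indep m₂ m₃ P) : Indep (m₁ ⊔ m₂) m₃ P := by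
  set p : Set (Set Ω) := {w | ∃ s t, MeasurableSet[m₁] s ∧ MeasurableSet[m₂] t ∧ w = s ∩ t}
  have hpi : IsPiSystem p := by
    rintro _ ⟨s, t, hs, ht, rfl⟩ _ ⟨s', t', hs', ht', rfl⟩ -
    exact ⟨s ∩ s', t ∩ t', hs.inter hs', ht.inter ht', Set.inter_inter_inter_comm _ _ _ _⟩
  have hgen : m₁ ⊔ m₂ = MeasurableSpace.generateFrom p := by
    refine le_antisymm (sup_le ?_ ?_) (MeasurableSpace.generateFrom_le ?_)
    · intro s hs
      exact MeasurableSpace.measurableSet_generateFrom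
        ⟨s, Set.univ, hs, MeasurableSet.univ, (Set.inter_univ s).symm⟩
    · intro t ht
      exact MeasurableSpace.measurableSet_generateFrom
        ⟨Set.univ, t, MeasurableSet.univ, ht, (Set.univ_inter t).symm⟩
    · rintro _ ⟨s, t, hs, ht, rfl⟩
      exact MeasurableSet.inter ((le_sup_left : m₁ ≤ m₁ ⊔ m₂) _ hs)
        ((le_sup_right : m₂ ≤ m₁ ⊔ m₂) _ ht)
  refine IndepSets.indep (sup_le h₁ h₂) h₃ hpi (@MeasurableSpace.isPiSystem_measurableSet Ω m₃)
    hgen MeasurableSpace.generateFrom_measurableSet.symm ?_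
  rw [IndepSets_iff]
  rintro _ u ⟨s, t, hs, ht, rfl⟩ hu
  have hu' : MeasurableSet[m₃] u := hu
  have htu : MeasurableSet[m₂ ⊔ m₃] (t ∩ u) :=
    MeasurableSet.inter ((le_sup_left : m₂ ≤ m₂ ⊔ m₃) _ ht)
      ((le_sup_right : m₃ ≤ m₂ ⊔ m₃) _ hu')
  rw [Indep_iff] at h h'
  rw [Set.inter_assoc, h s (t ∩ u) hs htu, h' t u ht hu',
    h s t hs ((le_sup_left : m₂ ≤ m₂ ⊔ m₃) _ ht), mul_assoc]

section Probability

variable {G : Type*} [Group G] [MeasurableSpace G] [Countable G] [DiscreteMeasurableSpace G]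
  {Ω : Type*} {mΩ : MeasurableSpace Ω} {P : Measure Ω}

theorem map_partialProd_eq_wordLaw [IsProbabilityMeasure P] {μ : Measure G} {l : ℕ → Option G}
    {y : ℕ → Ω → G} (hy : ∀ j, Measurable (y j)) (hind : iIndepFun y P)
    (hlaw : ∀ j, P.map (y j) = letterLaw μ (l j)) (n : ℕ) :
    P.map (fun ω => partialProd (fun j => y j ω) n) = wordLaw μ l n := by
  induction n with
  | zero => simp [partialProd, wordLaw]
  | succ n ih =>
    have hpast : Measurable[⨆ i ∈ Set.Iio n, MeasurableSpace.comap (y i) inferInstance]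
        fun ω => partialProd (fun j => y j ω) n :=
      measurable_partialProd fun j hj => measurable_iff_comap_le.2
        (le_biSup (fun i => MeasurableSpace.comap (y i) inferInstance) (Set.mem_Iio.2 hj))
    have h1 := indep_iSup_of_disjoint (fun i => (hy i).comap_le) hind.iIndep
      (S := Set.Iio n) (T := {n}) (by simp)
    have h2 : IndepFun (fun ω => partialProd (fun j => y j ω) n) (y n) P := by
      rw [IndepFun_iff_Indep]
      refine indep_of_indep_of_le h1 hpast.comap_le ?_
      exact le_biSup (fun i => MeasurableSpace.comap (y i) inferInstance) (Set.mem_singleton n)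
    have h3 := h2.map_mul_eq_map_mconv_map (measurable_partialProd fun j _ => hy j) (hy n)
    rw [wordLaw, ← ih, ← hlaw n]
    exact h3

/-- Freezing: the letters outside `J`, together with an event `E`, are independent of the letters
in `J`, and may be replaced by constants at the price of a supremum over these constants. -/
theorem measure_inter_partialProd_le {m₁ m₂ : MeasurableSpace Ω} (h₁ : m₁ ≤ mΩ)
    (hind : Indep m₁ m₂ P) (J : Set ℕ) [DecidablePred (· ∈ J)] (n : ℕ) {y z : ℕ → Ω → G}
    (hz : ∀ j < n, j ∉ J → Measurable[m₁] (z j)) (hy : ∀ j < n, j ∈ J → Measurable[m₂] (y j))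
    {E : Set Ω} (hE : MeasurableSet[m₁] E) (x : G) (r : ℝ≥0∞)
    (hr : ∀ c : ℕ → G, P {ω | partialProd (fun j => if j ∈ J then y j ω else c j) n = x} ≤ r) :
    P (E ∩ {ω | partialProd (fun j => if j ∈ J then y j ω else z j ω) n = x}) ≤ P E * r := by
  -- the values outside `J` are recorded in the countable type `Fin n → G`, with `1` on `J`
  let ext : (Fin n → G) → ℕ → G := fun c j => if h : j < n then c ⟨j, h⟩ else 1
  let A : (Fin n → G) → Set Ω :=
    fun c => E ∩ ⋂ j : Fin n, {ω | (if (j : ℕ) ∈ J then 1 else z j ω) = c j}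
  let B : (Fin n → G) → Set Ω :=
    fun c => {ω | partialProd (fun j => if j ∈ J then y j ω else ext c j) n = x}
  have hA : ∀ c, MeasurableSet[m₁] (A c) := by
    intro c
    refine MeasurableSet.inter hE (MeasurableSet.iInter fun j => ?_)
    have : Measurable[m₁] fun ω => if (j : ℕ) ∈ J then (1 : G) else z j ω := by
      by_cases hj : (j : ℕ) ∈ J
      · simp only [hj, if_true]; exact measurable_const
      · simp only [hj, if_false]; exact hz j j.2 hj
    exact this (measurableSet_singleton (c j))
  have hB : ∀ c, MeasurableSet[m₂] (B c) := by
    intro c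
    have : Measurable[m₂]
        fun ω => partialProd (fun j => if j ∈ J then y j ω else ext c j) n := by
      refine measurable_partialProd (y := fun j ω => if j ∈ J then y j ω else ext c j) ?_
      intro j hjn
      by_cases hj : j ∈ J
      · simp only [hj, if_true]; exact hy j hjn hj
      · simp only [hj, if_false]; exact measurable_const
    exact this (measurableSet_singleton x)
  have hcover : E ∩ {ω | partialProd (fun j => if j ∈ J then y j ω else z j ω) n = x} ⊆
      ⋃ c, A c ∩ B c := by
    rintro ω ⟨hω, hx⟩
    refine Set.mem_iUnion.2 ⟨fun j => if (j : ℕ) ∈ J then 1 else z j ω,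
      ⟨hω, Set.mem_iInter.2 fun j => rfl⟩, ?_⟩
    refine Eq.trans (partialProd_congr fun j hj => ?_) hx
    by_cases hjJ : j ∈ J <;> simp [hjJ, ext, hj]
  have hdisj : Pairwise (Function.onFun Disjoint A) := by
    intro c c' hcc
    refine Set.disjoint_left.2 fun ω h h' => hcc ?_
    funext j
    exact (Set.mem_iInter.1 h.2 j).symm.trans (Set.mem_iInter.1 h'.2 j)
  rw [Indep_iff] at hind
  calc P (E ∩ _) ≤ P (⋃ c, A c ∩ B c) := measure_mono hcover
    _ ≤ ∑' c, P (A c ∩ B c) := measure_iUnion_le _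
    _ = ∑' c, P (A c) * P (B c) := tsum_congr fun c => hind _ _ (hA c) (hB c)
    _ ≤ ∑' c, P (A c) * r := ENNReal.tsum_le_tsum fun c => mul_le_mul_right (hr (ext c)) _
    _ = P (⋃ c, A c) * r := by
      rw [ENNReal.tsum_mul_right, measure_iUnion hdisj fun c => h₁ _ (hA c)]
    _ ≤ P E * r := by
      refine mul_le_mul_left (measure_mono ?_) _
      exact Set.iUnion_subset fun c => Set.inter_subset_left

end Probability

/-! ### Isolated steps of the reinforced walk -/

/-- The step sequence determined by the coins `a`, the times `b`, the maps `T` and the samples `g`.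
The sample is also used where `b n` is outside the range `1 ≤ b n < n`, which makes the recursion
well founded and does not occur for a reinforced walk. -/
def stepSeq {G : Type*} (a : ℕ → Bool) (b : ℕ → ℕ) (T : ℕ → G → G) (g : ℕ → G) (n : ℕ) : G :=
  if _h : 2 ≤ n ∧ a n = true ∧ 1 ≤ b n ∧ b n < n then T n (stepSeq a b T g (b n)) else g n
  termination_by n

/-- Step `k` is isolated up to time `n` if it uses a fresh sample and is not repeated by any step
up to time `n`. -/
def IsIsolated (a : ℕ → Bool) (b : ℕ → ℕ) (n k : ℕ) : Prop :=
  a k = false ∧ ∀ j ∈ Finset.Icc (k + 1) n, ¬(a j = true ∧ b j = k)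

instance (a : ℕ → Bool) (b : ℕ → ℕ) (n : ℕ) : DecidablePred (IsIsolated a b n) :=
  fun _ => inferInstanceAs (Decidable (_ ∧ _))

/-- The isolated steps among the steps `2, …, n`. -/
def isolatedSet (a : ℕ → Bool) (b : ℕ → ℕ) (n : ℕ) : Finset ℕ :=
  (Finset.Icc 2 n).filter (IsIsolated a b n)

theorem stepSeq_of_coin_false {G : Type*} {a : ℕ → Bool} {b : ℕ → ℕ} {T : ℕ → G → G} {g : ℕ → G}
    {k : ℕ} (h : a k = false) : stepSeq a b T g k = g k := by
  rw [stepSeq, dif_neg (by simp [h])]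

/-- Changing the samples at isolated steps does not affect the other steps. -/
theorem stepSeq_congr_of_isolated {G : Type*} {a : ℕ → Bool} {b : ℕ → ℕ} {T : ℕ → G → G}
    {g g' : ℕ → G} {n : ℕ} {J : Finset ℕ} (hJ : J ⊆ isolatedSet a b n)
    (hg : ∀ k ∉ J, g k = g' k) (k : ℕ) (hk : k ∉ J) (hkn : k ≤ n) :
    stepSeq a b T g k = stepSeq a b T g' k := by
  induction k using Nat.strong_induction_on with
  | _ k ih =>
  by_cases h : 2 ≤ k ∧ a k = true ∧ 1 ≤ b k ∧ b k < k
  · rw [stepSeq, dif_pos h, stepSeq.eq_1 a b T g', dif_pos h, ih _ h.2.2.2 _ (by omega)]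
    intro hb
    have h1 := (Finset.mem_filter.1 (hJ hb)).2.2 k (Finset.mem_Icc.2 ⟨by omega, hkn⟩)
    exact h1 ⟨h.2.1, rfl⟩
  · rw [stepSeq, dif_neg h, stepSeq, dif_neg h, hg k hk]

theorem measurable_stepSeq {G Ω : Type*} [MeasurableSpace G] [Countable G]
    [DiscreteMeasurableSpace G] {m : MeasurableSpace Ω} {ξ : ℕ → Ω → Bool} {u : ℕ → Ω → ℕ}
    {T : ℕ → Ω → G → G} {g : ℕ → Ω → G} (hξ : ∀ n, 2 ≤ n → Measurable (ξ n))
    (hu : ∀ n, 2 ≤ n → Measurable (u n)) (hT : ∀ n, 2 ≤ n → Measurable (T n))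
    (hg : ∀ n, 1 ≤ n → Measurable (g n)) (n : ℕ) (hn : 1 ≤ n) :
    Measurable fun ω => stepSeq (ξ · ω) (u · ω) (T · ω) (g · ω) n := by
  induction n using Nat.strong_induction_on with
  | _ n ih =>
  by_cases hn2 : 2 ≤ n
  · let Y : Ω × ℕ → G := fun p =>
      if 1 ≤ p.2 ∧ p.2 < n then stepSeq (ξ · p.1) (u · p.1) (T · p.1) (g · p.1) p.2
      else g n p.1
    have hY : Measurable Y := by
      refine measurable_from_prod_countable_left fun k => ?_
      by_cases hk : 1 ≤ k ∧ k < n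
      · simp only [Y, hk, and_self, if_true]; exact ih k hk.2 hk.1
      · simp only [Y, hk, if_false]; exact hg n hn
    have heval : Measurable fun p : (G → G) × G => p.1 p.2 :=
      measurable_from_prod_countable_left fun y => measurable_pi_apply y
    have h1 : Measurable fun ω => T n ω (Y (ω, u n ω)) :=
      heval.comp ((hT n hn2).prodMk (hY.comp (measurable_id.prodMk (hu n hn2))))
    have hset : MeasurableSet {ω | 2 ≤ n ∧ ξ n ω = true ∧ 1 ≤ u n ω ∧ u n ω < n} := by
      have : {ω | 2 ≤ n ∧ ξ n ω = true ∧ 1 ≤ u n ω ∧ u n ω < n} =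
          (ξ n ⁻¹' {true}) ∩ (u n ⁻¹' {k | 1 ≤ k ∧ k < n}) := by
        ext ω; simp [hn2]
      rw [this]
      exact (hξ n hn2 (measurableSet_singleton _)).inter
        (hu n hn2 (MeasurableSet.of_discrete))
    have h2 : (fun ω => stepSeq (ξ · ω) (u · ω) (T · ω) (g · ω) n) = fun ω =>
        if 2 ≤ n ∧ ξ n ω = true ∧ 1 ≤ u n ω ∧ u n ω < n then T n ω (Y (ω, u n ω)) else g n ω := by
      funext ω
      rw [stepSeq]
      by_cases h : 2 ≤ n ∧ ξ n ω = true ∧ 1 ≤ u n ω ∧ u n ω < n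
      · rw [dif_pos h, if_pos h]
        simp only [Y, h.2.2, and_self, if_true]
      · rw [dif_neg h, if_neg h]
    rw [h2]
    exact Measurable.ite hset h1 (hg n hn)
  · convert hg n hn using 2 with ω
    rw [stepSeq, dif_neg (by tauto)]

theorem measurableSet_isolatedSet_eq {Ω : Type*} {m : MeasurableSpace Ω} {ξ : ℕ → Ω → Bool}
    {u : ℕ → Ω → ℕ} (hξ : ∀ n, 2 ≤ n → Measurable (ξ n)) (hu : ∀ n, 2 ≤ n → Measurable (u n))
    (n : ℕ) (J : Finset ℕ) : MeasurableSet {ω | isolatedSet (ξ · ω) (u · ω) n = J} := by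
  have hiso : ∀ k ∈ Finset.Icc 2 n, MeasurableSet {ω | IsIsolated (ξ · ω) (u · ω) n k} := by
    intro k hk
    have h2k := (Finset.mem_Icc.1 hk).1
    have : {ω | IsIsolated (ξ · ω) (u · ω) n k} =
        (ξ k ⁻¹' {false}) ∩ ⋂ j ∈ Finset.Icc (k + 1) n, (ξ j ⁻¹' {true} ∩ u j ⁻¹' {k})ᶜ := by
      ext ω; simp [IsIsolated]
    rw [this]
    refine (hξ k h2k (measurableSet_singleton _)).inter
      (Finset.measurableSet_biInter _ fun j hj => ?_)
    have h2j : 2 ≤ j := by have := (Finset.mem_Icc.1 hj).1; omega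
    exact ((hξ j h2j (measurableSet_singleton _)).inter
      (hu j h2j (measurableSet_singleton _))).compl
  by_cases hJ : J ⊆ Finset.Icc 2 n
  · have : {ω | isolatedSet (ξ · ω) (u · ω) n = J} = ⋂ k ∈ Finset.Icc 2 n,
        if k ∈ J then {ω | IsIsolated (ξ · ω) (u · ω) n k}
        else {ω | IsIsolated (ξ · ω) (u · ω) n k}ᶜ := by
      ext ω
      simp only [Set.mem_iInter]
      constructor
      · rintro rfl k hk
        by_cases h : IsIsolated (ξ · ω) (u · ω) n k <;>
          simp only [isolatedSet, Finset.mem_filter, hk, h, and_true, and_false, if_true,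
            if_false, Set.mem_compl_iff] <;> simpa using h
      · intro h
        ext k
        by_cases hk : k ∈ Finset.Icc 2 n
        · have := h k hk
          by_cases hkJ : k ∈ J <;> simp only [hkJ, if_true, if_false] at this <;>
            simpa [isolatedSet, hkJ, Finset.mem_Icc.1 hk] using this
        · have h1 : k ∉ J := fun h => hk (hJ h)
          simp only [isolatedSet, Finset.mem_filter, hk, h1, false_and]
    rw [this]
    refine Finset.measurableSet_biInter _ fun k hk => ?_
    split_ifs
    · exact hiso k hk
    · exact (hiso k hk).compl
  · convert MeasurableSet.empty using 1
    ext ω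
    simp only [Set.mem_empty_iff_false, iff_false]
    rintro rfl
    exact hJ (Finset.filter_subset _ _)

/-! ### Conditioning on everything but the isolated steps -/

section Driven

variable {G : Type*} [Group G] [MeasurableSpace G]
  {Ω : Type*} [mΩ : MeasurableSpace Ω] {P : Measure Ω}
  {α : ℝ} {μ : Measure G} {ξ : ℕ → Ω → Bool} {u : ℕ → Ω → ℕ} {T : ℕ → Ω → G → G}
  {g X S : ℕ → Ω → G}

theorem IsDrivenBy.step_eq (h : IsDrivenBy P α μ ξ u T g X S) (ω : Ω) (n : ℕ) (hn : 1 ≤ n) :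
    X n ω = stepSeq (ξ · ω) (u · ω) (T · ω) (g · ω) n := by
  induction n using Nat.strong_induction_on with
  | _ n ih =>
  rw [stepSeq]
  rcases hn.eq_or_lt with rfl | hn2
  · rw [dif_neg (by omega)]; exact h.step_one ω
  have hu := Finset.mem_Icc.1 (h.time_mem n hn2 ω)
  rw [h.step_succ n hn2 ω]
  by_cases hξ : ξ n ω = true
  · rw [dif_pos ⟨hn2, hξ, hu.1, by omega⟩, if_pos hξ, ih _ (by omega) hu.1]
  · rw [dif_neg (fun h => hξ h.2.1), if_neg hξ]

theorem IsDrivenBy.walk_eq (h : IsDrivenBy P α μ ξ u T g X S) (ω : Ω) (n : ℕ) :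
    S n ω = partialProd (fun j => X (j + 1) ω) n := by
  induction n with
  | zero => exact h.walk_zero ω
  | succ n ih => rw [h.walk_succ, ih]; rfl

theorem freeCount_eq_card {α : Type*} {J : Finset ℕ} {n : ℕ} (hJ : J ⊆ Finset.Icc 2 n)
    (c : ℕ → α) : freeCount (fun j => if j + 1 ∈ J then none else some (c j)) n = J.card := by
  rw [freeCount, Nat.count_eq_card_filter_range]
  refine Finset.card_bij (fun j _ => j + 1) ?_ (by simp) ?_
  · intro j hj
    by_contra hJ
    simp [hJ] at hj
  · intro k hk
    have := Finset.mem_Icc.1 (hJ hk)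
    refine ⟨k - 1, ?_, by omega⟩
    have h1 : k - 1 + 1 = k := by omega
    simp only [Finset.mem_filter, Finset.mem_range, h1, hk, if_true, Option.isNone_none, and_true]
    omega

/-- The samples with index in `J` are independent of everything else that drives the walk. -/
theorem IsDrivenBy.exists_indep [IsProbabilityMeasure P]
    (h : IsDrivenBy P α μ ξ u T g X S) (J : Finset ℕ) :
    ∃ m₁ m₂ : MeasurableSpace Ω, m₁ ≤ mΩ ∧ Indep m₁ m₂ P ∧
      (∀ n, 2 ≤ n → Measurable[m₁] (ξ n)) ∧ (∀ n, 2 ≤ n → Measurable[m₁] (u n)) ∧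
      (∀ n, 2 ≤ n → Measurable[m₁] (T n)) ∧ (∀ n, 1 ≤ n → n ∉ J → Measurable[m₁] (g n)) ∧
      ∀ n, 1 ≤ n → n ∈ J → Measurable[m₂] (g n) := by
  have hcoin := h.measurable_coin
  have htime := h.measurable_time
  have hmap := h.measurable_map
  have hfresh := h.measurable_fresh
  have hdrive := h.indep_fresh_drive.symm
  have hiid := h.indep_fresh.iIndep
  rw [IndepFun_iff_Indep] at hdrive
  let D : Ω → {n : ℕ // 2 ≤ n} → Bool × ℕ × (G → G) := fun ω n => (ξ n ω, u n ω, T n ω)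
  have hDmeas : Measurable D := measurable_pi_lambda _ fun n =>
    (hcoin n n.2).prodMk ((htime n n.2).prodMk (hmap n n.2))
  let f : {n : ℕ // 1 ≤ n} → MeasurableSpace Ω :=
    fun n => MeasurableSpace.comap (g n) inferInstance
  have hf : ∀ k, f k ≤ mΩ := fun k => (hfresh k k.2).comap_le
  have hindAB := indep_iSup_of_disjoint hf hiid
    (S := {k : {n : ℕ // 1 ≤ n} | (k : ℕ) ∉ J}) (T := {k : {n : ℕ // 1 ≤ n} | (k : ℕ) ∈ J})
    (Set.disjoint_left.2 fun k hk hk' => hk hk')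
  have hall : ∀ k, f k ≤ MeasurableSpace.comap
      (fun ω (n : {n : ℕ // 1 ≤ n}) => g n ω) inferInstance := fun k =>
    Measurable.comap_le ((measurable_pi_apply k).comp
      (comap_measurable fun ω (n : {n : ℕ // 1 ≤ n}) => g n ω))
  set mD : MeasurableSpace Ω := MeasurableSpace.comap D inferInstance
  set mA : MeasurableSpace Ω := ⨆ k ∈ {k : {n : ℕ // 1 ≤ n} | (k : ℕ) ∉ J}, f k with hmA
  set mB : MeasurableSpace Ω := ⨆ k ∈ {k : {n : ℕ // 1 ≤ n} | (k : ℕ) ∈ J}, f k with hmB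
  have hAle : mA ≤ mΩ := iSup₂_le fun k _ => hf k
  have hBle : mB ≤ mΩ := iSup₂_le fun k _ => hf k
  have hDle : mD ≤ mΩ := hDmeas.comap_le
  have hindD : Indep mD (mA ⊔ mB) P :=
    indep_of_indep_of_le_right hdrive
      (sup_le (iSup₂_le fun k _ => hall k) (iSup₂_le fun k _ => hall k))
  have hDn : ∀ n, 2 ≤ n → Measurable[mD ⊔ mA] fun ω => (ξ n ω, u n ω, T n ω) := fun n hn =>
    ((measurable_pi_apply (⟨n, hn⟩ : {n : ℕ // 2 ≤ n})).comp (comap_measurable D)).mono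
      le_sup_left le_rfl
  refine ⟨mD ⊔ mA, mB, sup_le hDle hAle, indep_sup_left hDle hAle hBle hindD hindAB,
    fun n hn => measurable_fst.comp (hDn n hn),
    fun n hn => measurable_fst.comp (measurable_snd.comp (hDn n hn)),
    fun n hn => measurable_snd.comp (measurable_snd.comp (hDn n hn)), fun n hn hnJ => ?_,
    fun n hn hnJ => ?_⟩
  · refine Measurable.mono (comap_measurable (g n)) ?_ le_rfl
    refine le_trans ?_ (le_sup_right : mA ≤ mD ⊔ mA)
    exact le_biSup f (i := ⟨n, hn⟩)
      (s := {k : {n : ℕ // 1 ≤ n} | (k : ℕ) ∉ J}) hnJ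
  · refine Measurable.mono (comap_measurable (g n)) ?_ le_rfl
    exact le_biSup f (i := ⟨n, hn⟩)
      (s := {k : {n : ℕ // 1 ≤ n} | (k : ℕ) ∈ J}) hnJ

variable [Countable G] [DiscreteMeasurableSpace G] [IsProbabilityMeasure P]

theorem IsDrivenBy.measure_partialProd_eq (h : IsDrivenBy P α μ ξ u T g X S) (n : ℕ)
    (J : Finset ℕ) (c : ℕ → G) (x : G) :
    P {ω | partialProd (fun j => if j + 1 ∈ J then g (j + 1) ω else c j) n = x} =
      wordLaw μ (fun j => if j + 1 ∈ J then none else some (c j)) n {x} := by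
  have hmeas : ∀ j, Measurable fun ω => if j + 1 ∈ J then g (j + 1) ω else c j := by
    intro j
    by_cases hj : j + 1 ∈ J
    · simp only [hj, if_true]; exact h.measurable_fresh _ (by omega)
    · simp only [hj, if_false]; exact measurable_const
  have hindep : iIndepFun (fun j ω => if j + 1 ∈ J then g (j + 1) ω else c j) P := by
    have h1 : iIndepFun (fun j : ℕ => g (j + 1)) P :=
      h.indep_fresh.precomp (g := fun j : ℕ => (⟨j + 1, by omega⟩ : {n : ℕ // 1 ≤ n}))
        (fun i j hij => by simpa using hij)
    exact h1.comp (fun j y => if j + 1 ∈ J then y else c j) (fun j => Measurable.of_discrete)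
  have hlaw : ∀ j, P.map (fun ω => if j + 1 ∈ J then g (j + 1) ω else c j) =
      letterLaw μ (if j + 1 ∈ J then none else some (c j)) := by
    intro j
    by_cases hj : j + 1 ∈ J
    · simp only [hj, if_true, letterLaw]; exact h.fresh_law _ (by omega)
    · simp [hj, letterLaw]
  rw [← map_partialProd_eq_wordLaw (l := fun j => if j + 1 ∈ J then none else some (c j))
    hmeas hindep hlaw n, Measure.map_apply (measurable_partialProd fun j _ => hmeas j)
    (measurableSet_singleton x)]
  rfl

variable [IsProbabilityMeasure μ]

/-- Given the set `J` of isolated steps, the walk is a word whose free letters are the steps in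
`J`. -/
theorem IsDrivenBy.measure_isolatedSet_inter_le (h : IsDrivenBy P α μ ξ u T g X S) (n : ℕ)
    {J : Finset ℕ} (hJ : J ⊆ Finset.Icc 2 n) (x : G) (r : ℝ)
    (hr : ∀ l : ℕ → Option G, freeCount l n = J.card → (wordLaw μ l n).real {x} ≤ r) :
    P ({ω | isolatedSet (ξ · ω) (u · ω) n = J} ∩ {ω | S n ω = x}) ≤
      P {ω | isolatedSet (ξ · ω) (u · ω) n = J} * ENNReal.ofReal r := by
  -- the samples with the isolated ones erased
  let g' : ℕ → Ω → G := fun k ω => if k ∈ J then 1 else g k ω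
  have hsub : {ω | isolatedSet (ξ · ω) (u · ω) n = J} ∩ {ω | S n ω = x} ⊆
      {ω | isolatedSet (ξ · ω) (u · ω) n = J} ∩
        {ω | partialProd (fun j => if j + 1 ∈ J then g (j + 1) ω
          else stepSeq (ξ · ω) (u · ω) (T · ω) (g' · ω) (j + 1)) n = x} := by
    rintro ω ⟨hω, hx⟩
    refine ⟨hω, ?_⟩
    have hω' : isolatedSet (ξ · ω) (u · ω) n = J := hω
    have hx' : S n ω = x := hx
    rw [h.walk_eq] at hx'
    refine Eq.trans (partialProd_congr fun j hj => ?_) hx'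
    rw [h.step_eq ω (j + 1) (by omega)]
    by_cases hjJ : j + 1 ∈ J
    · rw [if_pos hjJ, stepSeq_of_coin_false]
      rw [← hω'] at hjJ
      exact (Finset.mem_filter.1 hjJ).2.1
    · rw [if_neg hjJ]
      refine stepSeq_congr_of_isolated hω'.ge (fun k hk => ?_) _ hjJ (by omega)
      simp [g', hk]
  have hword : ∀ c : ℕ → G,
      P {ω | partialProd (fun j => if j + 1 ∈ J then g (j + 1) ω else c j) n = x} ≤
        ENNReal.ofReal r := by
    intro c
    rw [h.measure_partialProd_eq, ← ofReal_measureReal]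
    exact ENNReal.ofReal_le_ofReal (hr _ (freeCount_eq_card hJ c))
  refine (measure_mono hsub).trans ?_
  obtain ⟨m₁, m₂, hm₁, hind, hξ, hu, hT, hgA, hgB⟩ := h.exists_indep J
  have hg' : ∀ n, 1 ≤ n → Measurable[m₁] (g' n) := by
    intro n hn
    by_cases hnJ : n ∈ J
    · simp only [g', hnJ, if_true]; exact measurable_const
    · simp only [g', hnJ, if_false]; exact hgA n hn hnJ
  exact measure_inter_partialProd_le hm₁ hind {j | j + 1 ∈ J} n
    (y := fun j => g (j + 1))
    (z := fun j ω => stepSeq (ξ · ω) (u · ω) (T · ω) (g' · ω) (j + 1))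
    (fun j _ _ => measurable_stepSeq hξ hu hT hg' (j + 1) (by omega))
    (fun j _ hj => hgB (j + 1) (by omega) hj)
    (measurableSet_isolatedSet_eq hξ hu n J) x (ENNReal.ofReal r) hword

/-- The bound for words, averaged over the set of isolated steps. -/
theorem IsDrivenBy.measure_walk_eq_le (h : IsDrivenBy P α μ ξ u T g X S) (n m : ℕ) (x : G)
    {r : ℝ} (hr0 : 0 ≤ r)
    (hr : ∀ l : ℕ → Option G, m ≤ freeCount l n → (wordLaw μ l n).real {x} ≤ r) :
    P.real {ω | S n ω = x} ≤
      r + P.real {ω | (isolatedSet (ξ · ω) (u · ω) n).card < m} := by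
  let F := (Finset.Icc 2 n).powerset.filter fun J => m ≤ J.card
  have hcover : {ω | S n ω = x} ⊆
      (⋃ J ∈ F, ({ω | isolatedSet (ξ · ω) (u · ω) n = J} ∩ {ω | S n ω = x})) ∪
        {ω | (isolatedSet (ξ · ω) (u · ω) n).card < m} := by
    intro ω hω
    by_cases hc : (isolatedSet (ξ · ω) (u · ω) n).card < m
    · exact Or.inr hc
    · refine Or.inl (Set.mem_biUnion (x := isolatedSet (ξ · ω) (u · ω) n) ?_ ⟨rfl, hω⟩)
      simp only [F, Finset.coe_filter, Finset.mem_powerset, Set.mem_ofPred_eq]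
      exact ⟨Finset.filter_subset _ _, not_lt.1 hc⟩
  have hsum : P (⋃ J ∈ F, ({ω | isolatedSet (ξ · ω) (u · ω) n = J} ∩ {ω | S n ω = x})) ≤
      ENNReal.ofReal r := by
    calc _ ≤ ∑ J ∈ F, P ({ω | isolatedSet (ξ · ω) (u · ω) n = J} ∩ {ω | S n ω = x}) :=
          measure_biUnion_finset_le _ _
      _ ≤ ∑ J ∈ F, P {ω | isolatedSet (ξ · ω) (u · ω) n = J} * ENNReal.ofReal r := by
          refine Finset.sum_le_sum fun J hJ => ?_
          simp only [F, Finset.mem_filter, Finset.mem_powerset] at hJ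
          exact h.measure_isolatedSet_inter_le n hJ.1 x r fun l hl => hr l (hJ.2.trans hl.ge)
      _ = P (⋃ J ∈ F, {ω | isolatedSet (ξ · ω) (u · ω) n = J}) * ENNReal.ofReal r := by
          rw [← Finset.sum_mul, measure_biUnion_finset]
          · intro J _ J' _ hJJ
            refine Set.disjoint_left.2 fun ω h h' => hJJ ?_
            exact Eq.trans (Eq.symm h) h'
          · exact fun J _ => measurableSet_isolatedSet_eq h.measurable_coin h.measurable_time n J
      _ ≤ 1 * ENNReal.ofReal r := mul_le_mul_left prob_le_one _
      _ = ENNReal.ofReal r := one_mul _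
  have h1 := (measureReal_mono (μ := P) hcover).trans (measureReal_union_le _ _)
  have h2 : P.real (⋃ J ∈ F, ({ω | isolatedSet (ξ · ω) (u · ω) n = J} ∩ {ω | S n ω = x})) ≤ r :=
    ENNReal.toReal_le_of_le_ofReal hr0 hsum
  linarith

end Driven

/-! ### There are linearly many isolated steps -/

/-- Hoeffding's inequality for independent variables in the unit interval with means at most `p`. -/
theorem hoeffding_unitInterval {Ω ι : Type*} [MeasurableSpace Ω] {P : Measure Ω}
    [IsProbabilityMeasure P] {Y : ι → Ω → ℝ} (hind : iIndepFun Y P) (s : Finset ι)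
    (hmeas : ∀ i, Measurable (Y i)) (hY : ∀ i ω, Y i ω ∈ Set.Icc (0 : ℝ) 1) {p ε : ℝ} (hε : 0 ≤ ε)
    (hp : ∀ i ∈ s, ∫ ω, Y i ω ∂P ≤ p) :
    P.real {ω | (p + ε) * s.card ≤ ∑ i ∈ s, Y i ω} ≤ Real.exp (-(2 * ε ^ 2 * s.card)) := by
  have hind' : iIndepFun (fun i ω => Y i ω - ∫ ω, Y i ω ∂P) P :=
    hind.comp (fun i y => y - ∫ ω, Y i ω ∂P) fun i => measurable_id.sub_const _
  have h1 := HasSubgaussianMGF.measure_sum_ge_le_of_iIndepFun hind' (s := s)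
    (fun i _ => hasSubgaussianMGF_of_mem_Icc (hmeas i).aemeasurable (ae_of_all _ (hY i)))
    (ε := ε * s.card) (by positivity)
  refine (measureReal_mono fun ω hω => ?_).trans (h1.trans (le_of_eq ?_))
  · simp only [Set.mem_ofPred_eq] at hω ⊢
    have h2 := Finset.sum_le_card_nsmul s _ p hp
    rw [nsmul_eq_mul] at h2
    rw [Finset.sum_sub_distrib]
    linarith
  · congr 1
    simp only [Finset.sum_const]
    rcases s.card.eq_zero_or_pos with h | h
    · simp [h]
    · have : (0 : ℝ) < s.card := by exact_mod_cast h
      simp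
      field_simp

/-- A fresh step of the window `(n - w, n]` is isolated unless it is repeated by another step of the
window. -/
theorem card_coin_false_le {a : ℕ → Bool} {b : ℕ → ℕ} {n w : ℕ} (hw : w < n) :
    ((Finset.Ioc (n - w) n).filter fun k => a k = false).card ≤ (isolatedSet a b n).card +
      ((Finset.Ioc (n - w) n).filter fun j => b j ∈ Finset.Ioc (n - w) n).card := by
  classical
  have hsub : ((Finset.Ioc (n - w) n).filter fun k => a k = false) ⊆ isolatedSet a b n ∪
      ((Finset.Ioc (n - w) n).filter fun j => b j ∈ Finset.Ioc (n - w) n).image b := by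
    intro k hk
    obtain ⟨hkW, hak⟩ := Finset.mem_filter.1 hk
    obtain ⟨hk1, hk2⟩ := Finset.mem_Ioc.1 hkW
    by_cases hiso : IsIsolated a b n k
    · exact Finset.mem_union_left _ (Finset.mem_filter.2 ⟨Finset.mem_Icc.2 ⟨by omega, hk2⟩, hiso⟩)
    · refine Finset.mem_union_right _ (Finset.mem_image.2 ?_)
      simp only [IsIsolated, hak, true_and, not_forall, not_not] at hiso
      obtain ⟨j, hj, -, hbj⟩ := hiso
      obtain ⟨hj1, hj2⟩ := Finset.mem_Icc.1 hj
      exact ⟨j, Finset.mem_filter.2 ⟨Finset.mem_Ioc.2 ⟨by omega, hj2⟩, by rwa [hbj]⟩, hbj⟩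
  exact (Finset.card_le_card hsub).trans ((Finset.card_union_le _ _).trans
    (Nat.add_le_add_left Finset.card_image_le _))

section Driven

variable {G : Type*} [Group G] [MeasurableSpace G]
  {Ω : Type*} [MeasurableSpace Ω] {P : Measure Ω} [IsProbabilityMeasure P]
  {α : ℝ} {μ : Measure G} {ξ : ℕ → Ω → Bool} {u : ℕ → Ω → ℕ} {T : ℕ → Ω → G → G}
  {g X S : ℕ → Ω → G}

theorem IsDrivenBy.measure_coins_le (h : IsDrivenBy P α μ ξ u T g X S) (hα₀ : 0 ≤ α)
    (W : Finset ℕ) (hW : ∀ k ∈ W, 2 ≤ k) {ε : ℝ} (hε : 0 ≤ ε) :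
    P.real {ω | (α + ε) * W.card ≤ ((W.filter fun k => ξ k ω = true).card : ℝ)} ≤
      Real.exp (-(2 * ε ^ 2 * W.card)) := by
  have hcard : (W.subtype fun n => 2 ≤ n).card = W.card := by
    rw [Finset.card_subtype, Finset.filter_true_of_mem hW]
  have hind := h.indep_coin.comp (fun _ (c : Bool) => if c = true then (1 : ℝ) else 0)
    (fun _ => Measurable.of_discrete)
  have h1 := hoeffding_unitInterval hind (W.subtype fun n => 2 ≤ n)
    (fun i => Measurable.of_discrete.comp (h.measurable_coin i i.2))
    (fun i ω => by simp only [Function.comp]; split_ifs <;> simp) (p := α) hε (by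
      intro i _
      have h2 : (fun ω => ((fun c : Bool => if c = true then (1 : ℝ) else 0) ∘ ξ i) ω) =
          Set.indicator {ω | ξ i ω = true} 1 := by
        funext ω; simp [Set.indicator]
      have hm : MeasurableSet {ω | ξ i ω = true} :=
        h.measurable_coin i i.2 (measurableSet_singleton true)
      rw [h2, integral_indicator_one hm,
        Measure.real, h.coin_law i i.2, ENNReal.toReal_ofReal hα₀])
  rw [hcard] at h1
  refine le_trans (le_of_eq ?_) h1
  congr 1
  ext ω
  simp only [Set.mem_ofPred_eq, Function.comp]
  rw [Finset.sum_subtype_of_mem (fun k => if ξ k ω = true then (1 : ℝ) else 0) hW,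
    Finset.sum_boole]

/-- For `j` in the window `(n - w, n]` the time `u j` is uniform on at least `n - w` values, hence
in the window with probability at most `w / (n - w)`. -/
theorem IsDrivenBy.measure_times_le (h : IsDrivenBy P α μ ξ u T g X S) {n w : ℕ} (hw : w < n)
    {p ε : ℝ} (hp : (w : ℝ) / (n - w : ℕ) ≤ p) (hε : 0 ≤ ε) :
    P.real {ω | (p + ε) * w ≤ (((Finset.Ioc (n - w) n).filter
      fun j => u j ω ∈ Finset.Ioc (n - w) n).card : ℝ)} ≤ Real.exp (-(2 * ε ^ 2 * w)) := by
  set W := Finset.Ioc (n - w) n with hWdef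
  have hWcard : W.card = w := by rw [hWdef, Nat.card_Ioc]; omega
  have hW : ∀ k ∈ W, 2 ≤ k := fun k hk => by
    have := Finset.mem_Ioc.1 hk; omega
  have hcard : (W.subtype fun n => 2 ≤ n).card = w := by
    rw [Finset.card_subtype, Finset.filter_true_of_mem hW, hWcard]
  have hind := h.indep_time.comp (fun _ (c : ℕ) => if c ∈ W then (1 : ℝ) else 0)
    (fun _ => Measurable.of_discrete)
  have h1 := hoeffding_unitInterval hind (W.subtype fun n => 2 ≤ n)
    (fun i => Measurable.of_discrete.comp (h.measurable_time i i.2))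
    (fun i ω => by simp only [Function.comp]; split_ifs <;> simp) (p := p) hε (by
      intro i hi
      have hiW : (i : ℕ) ∈ W := Finset.mem_subtype.1 hi
      have hiW' := Finset.mem_Ioc.1 hiW
      have h2 : (fun ω => ((fun c : ℕ => if c ∈ W then (1 : ℝ) else 0) ∘ u i) ω) =
          Set.indicator {ω | u i ω ∈ W} 1 := by
        funext ω; simp [Set.indicator]
      have hm : MeasurableSet {ω | u i ω ∈ W} :=
        h.measurable_time i i.2 (MeasurableSet.of_discrete (s := {k | k ∈ W}))
      rw [h2, integral_indicator_one hm]
      refine le_trans ?_ hp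
      have hcover : {ω | u i ω ∈ W} ⊆ ⋃ k ∈ W ∩ Finset.Icc 1 (i - 1), {ω | u i ω = k} := by
        intro ω hω
        exact Set.mem_biUnion (x := u i ω)
          (Finset.mem_coe.2 (Finset.mem_inter.2 ⟨hω, h.time_mem i i.2 ω⟩)) rfl
      have hpos : (0 : ℝ) < (n - w : ℕ) := by
        have : 0 < n - w := by omega
        exact_mod_cast this
      calc P.real {ω | u i ω ∈ W}
          ≤ ∑ k ∈ W ∩ Finset.Icc 1 (i - 1), P.real {ω | u i ω = k} :=
            (measureReal_mono hcover (measure_ne_top _ _)).trans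
              (measureReal_biUnion_finset_le _ _)
        _ ≤ ∑ k ∈ W ∩ Finset.Icc 1 (i - 1), ((n - w : ℕ) : ℝ)⁻¹ := by
            refine Finset.sum_le_sum fun k hk => ?_
            rw [Measure.real, h.time_law i i.2 k (Finset.mem_inter.1 hk).2, ENNReal.toReal_inv,
              ENNReal.toReal_natCast]
            refine inv_anti₀ hpos ?_
            exact_mod_cast (by omega : n - w ≤ i - 1)
        _ ≤ w / (n - w : ℕ) := by
            rw [Finset.sum_const, nsmul_eq_mul, div_eq_mul_inv]
            refine mul_le_mul_of_nonneg_right ?_ (by positivity)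
            rw [← hWcard]
            exact_mod_cast Finset.card_le_card Finset.inter_subset_left)
  rw [hcard] at h1
  refine le_trans (le_of_eq ?_) h1
  congr 1
  ext ω
  simp only [Set.mem_ofPred_eq, Function.comp]
  rw [Finset.sum_subtype_of_mem (fun k => if u k ω ∈ W then (1 : ℝ) else 0) hW,
    Finset.sum_boole]

/-- In a window of the last `w` steps about `(1 - α) w` steps are fresh, while a step of the window
repeats a step of the window with probability at most `w / (n - w)`, which is small compared with
`1 - α`. -/
theorem IsDrivenBy.measure_isolatedSet_window_le (h : IsDrivenBy P α μ ξ u T g X S) (hα₀ : 0 ≤ α)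
    (hα₁ : α < 1) {n w : ℕ} (hn : 1 ≤ n) (hw : 16 * (w : ℝ) ≤ (1 - α) * n) :
    P.real {ω | ((isolatedSet (ξ · ω) (u · ω) n).card : ℝ) ≤ (1 - α) * w / 4} ≤
      2 * Real.exp (-((1 - α) ^ 2 * w / 32)) := by
  set q := 1 - α with hq
  have hq0 : 0 < q := by linarith
  have hq1 : q ≤ 1 := by linarith
  have hn0 : (1 : ℝ) ≤ n := by exact_mod_cast hn
  have hw0 : (0 : ℝ) ≤ w := Nat.cast_nonneg _
  have hwn : w < n := by
    have : (w : ℝ) < n := by nlinarith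
    exact_mod_cast this
  have hWcard : (Finset.Ioc (n - w) n).card = w := by rw [Nat.card_Ioc]; omega
  have hp : (w : ℝ) / (n - w : ℕ) ≤ q / 8 := by
    have hcast : ((n - w : ℕ) : ℝ) = n - w := by rw [Nat.cast_sub hwn.le]
    have hpos : (0 : ℝ) < (n : ℝ) - w := by
      have : (w : ℝ) < n := by exact_mod_cast hwn
      linarith
    rw [hcast, div_le_iff₀ hpos]
    nlinarith
  have h1 := h.measure_coins_le hα₀ (Finset.Ioc (n - w) n)
    (fun k hk => by have := Finset.mem_Ioc.1 hk; omega) (ε := q / 2) (by positivity)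
  have h2 := h.measure_times_le hwn hp (ε := q / 8) (by positivity)
  rw [hWcard] at h1
  have hexp1 : Real.exp (-(2 * (q / 2) ^ 2 * w)) ≤ Real.exp (-(q ^ 2 * w / 32)) := by
    refine Real.exp_le_exp.2 ?_
    have : 0 ≤ q ^ 2 * w := by positivity
    linarith
  have hexp2 : Real.exp (-(2 * (q / 8) ^ 2 * w)) = Real.exp (-(q ^ 2 * w / 32)) := by
    congr 1; ring
  have hcover : {ω | ((isolatedSet (ξ · ω) (u · ω) n).card : ℝ) ≤ q * w / 4} ⊆
      {ω | (α + q / 2) * w ≤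
        (((Finset.Ioc (n - w) n).filter fun k => ξ k ω = true).card : ℝ)} ∪
      {ω | (q / 8 + q / 8) * w ≤ (((Finset.Ioc (n - w) n).filter
        fun j => u j ω ∈ Finset.Ioc (n - w) n).card : ℝ)} := by
    intro ω hω
    by_contra hcon
    simp only [Set.mem_union, Set.mem_ofPred_eq, not_or, not_le] at hcon hω
    have h3 := card_coin_false_le (a := (ξ · ω)) (b := (u · ω)) hwn
    have h4 := Finset.card_filter_add_card_filter_not (s := Finset.Ioc (n - w) n)
      (fun k => ξ k ω = true)
    simp only [Bool.not_eq_true] at h4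
    rw [hWcard] at h4
    have h3' : (((Finset.Ioc (n - w) n).filter fun k => ξ k ω = false).card : ℝ) ≤
      (isolatedSet (ξ · ω) (u · ω) n).card + ((Finset.Ioc (n - w) n).filter
        fun j => u j ω ∈ Finset.Ioc (n - w) n).card := by exact_mod_cast h3
    have h4' : (((Finset.Ioc (n - w) n).filter fun k => ξ k ω = true).card : ℝ) +
      ((Finset.Ioc (n - w) n).filter fun k => ξ k ω = false).card = w := by exact_mod_cast h4
    have hα : α * (w : ℝ) = w - q * w := by rw [hq]; ring
    nlinarith [hcon.1, hcon.2]
  have h5 := (measureReal_mono (μ := P) hcover).trans (measureReal_union_le _ _)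
  linarith

/-- Up to an exponentially small probability there are linearly many isolated steps. -/
theorem IsDrivenBy.measure_isolatedSet_le (h : IsDrivenBy P α μ ξ u T g X S) (hα₀ : 0 ≤ α)
    (hα₁ : α < 1) {n k : ℕ} (hn : 1 ≤ n) (hk : (k : ℝ) ≤ (1 - α) ^ 2 / 256 * n) :
    P.real {ω | (isolatedSet (ξ · ω) (u · ω) n).card < 2 * k} ≤
      3 * Real.exp (-((1 - α) ^ 3 / 1024 * n)) := by
  set q := 1 - α with hq
  have hq0 : 0 < q := by linarith
  have hq1 : q ≤ 1 := by linarith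
  have hn0 : (1 : ℝ) ≤ n := by exact_mod_cast hn
  rcases lt_or_ge (q * n) 32 with hsmall | hlarge
  · -- few steps: the right-hand side is at least `1`
    refine measureReal_le_one.trans ?_
    have h1 : q ^ 3 / 1024 * n ≤ 1 / 2 := by
      have : q ^ 3 * n = q ^ 2 * (q * n) := by ring
      have h2 : q ^ 2 * (q * n) ≤ 1 * 32 :=
        mul_le_mul (pow_le_one₀ hq0.le hq1) hsmall.le (by positivity) zero_le_one
      linarith
    have h2 := Real.add_one_le_exp (-(q ^ 3 / 1024 * n))
    linarith
  · set w := ⌊q * n / 16⌋₊ with hw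
    have hwle : (w : ℝ) ≤ q * n / 16 := Nat.floor_le (by positivity)
    have hwge : q * n / 32 ≤ w := by
      have := (Nat.lt_floor_add_one (q * n / 16)).le
      linarith
    have h1 := h.measure_isolatedSet_window_le hα₀ hα₁ hn (w := w) (by rw [← hq]; linarith)
    rw [← hq] at h1
    have h2 : {ω | (isolatedSet (ξ · ω) (u · ω) n).card < 2 * k} ⊆
        {ω | ((isolatedSet (ξ · ω) (u · ω) n).card : ℝ) ≤ q * w / 4} := by
      intro ω hω
      simp only [Set.mem_ofPred_eq] at hω ⊢
      have h3 : ((isolatedSet (ξ · ω) (u · ω) n).card : ℝ) ≤ 2 * k := by exact_mod_cast hω.le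
      nlinarith
    refine (measureReal_mono h2).trans (h1.trans ?_)
    have h4 : Real.exp (-(q ^ 2 * w / 32)) ≤ Real.exp (-(q ^ 3 / 1024 * n)) := by
      refine Real.exp_le_exp.2 (neg_le_neg ?_)
      have := mul_le_mul_of_nonneg_left hwge (sq_nonneg q)
      nlinarith
    have := Real.exp_pos (-(q ^ 3 / 1024 * n))
    linarith

end Driven

/-! ### Return probabilities and transience -/

/-- The Borel–Cantelli lemma, applied to each of the countably many points of `G`. -/
theorem isTransient_of_summable {G Ω : Type*} [Countable G] [MeasurableSpace Ω] {P : Measure Ω}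
    [IsProbabilityMeasure P] {S : ℕ → Ω → G}
    (h : ∀ x, Summable fun n => P.real {ω | S n ω = x}) : IsTransient P S := by
  have h1 : ∀ x, ∀ᵐ ω ∂P, ∀ᶠ n in atTop, ω ∉ {ω | S n ω = x} := by
    intro x
    refine ae_eventually_notMem ?_
    have h2 : ∀ n, P {ω | S n ω = x} = ENNReal.ofReal (P.real {ω | S n ω = x}) :=
      fun n => (ofReal_measureReal).symm
    simp_rw [h2]
    exact (h x).tsum_ofReal_ne_top
  rw [IsTransient]
  filter_upwards [ae_all_iff.2 h1] with ω hω
  intro s hs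
  have h3 : ∀ᶠ n in atTop, ∀ x ∈ sᶜ, ω ∉ {ω | S n ω = x} :=
    (eventually_all_finite (mem_cofinite.1 hs)).2 fun x _ => hω x
  rw [mem_map]
  filter_upwards [h3] with n hn
  by_contra hmem
  exact hn (S n ω) hmem rfl

section Main

variable {G : Type*} [Group G] [Countable G] [MeasurableSpace G] [DiscreteMeasurableSpace G]
  {μ : Measure G} [IsProbabilityMeasure μ] {α : ℝ}

/-- A uniform bound for words with `2 k` free letters bounds the walk at times `n ≥ C k`, up to an
exponentially small error. -/
theorem IsGeneralizedSRRW.measure_eq_le {Ω : Type*} [MeasurableSpace Ω] {P : Measure Ω}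
    [IsProbabilityMeasure P] {S : ℕ → Ω → G} (h : IsGeneralizedSRRW P α μ S) (hα₀ : 0 ≤ α)
    (hα₁ : α < 1) {n k : ℕ} (hn : 1 ≤ n) (hk : (k : ℝ) ≤ (1 - α) ^ 2 / 256 * n) (x : G) {r : ℝ}
    (hr0 : 0 ≤ r)
    (hr : ∀ l : ℕ → Option G, 2 * k ≤ freeCount l n → (wordLaw μ l n).real {x} ≤ r) :
    P.real {ω | S n ω = x} ≤ r + 3 * Real.exp (-((1 - α) ^ 3 / 1024 * n)) := by
  obtain ⟨ξ, u, T, g, X, hd⟩ := h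
  have h1 := hd.measure_walk_eq_le n (2 * k) x hr0 hr
  have h2 := hd.measure_isolatedSet_le hα₀ hα₁ hn hk
  linarith

theorem exists_exp_neg_le_mul_rpow {a c : ℝ} (ha : 0 < a) (hc : 0 < c) :
    ∃ C > 0, ∀ x : ℝ, 0 < x → Real.exp (-(c * x)) ≤ C * x ^ (-a) := by
  refine ⟨(a / c) ^ a, by positivity, fun x hx => ?_⟩
  have h1 : x ≤ a / c * Real.exp (c * x / a) := by
    have := Real.add_one_le_exp (c * x / a)
    calc x = a / c * (c * x / a) := by field_simp
      _ ≤ a / c * Real.exp (c * x / a) := by gcongr; linarith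
  have h2 := Real.rpow_le_rpow hx.le h1 ha.le
  rw [Real.mul_rpow (by positivity) (Real.exp_pos _).le, ← Real.exp_mul,
    div_mul_cancel₀ _ ha.ne'] at h2
  rw [Real.rpow_neg hx.le, Real.exp_neg, ← div_eq_mul_inv, inv_le_iff_one_le_mul₀ (Real.exp_pos _),
    div_mul_eq_mul_div, le_div_iff₀ (Real.rpow_pos_of_pos hx a)]
  linarith

theorem exists_measure_eq_le_of_polynomialGrowth (hα₀ : 0 ≤ α) (hα₁ : α < 1) (hone : 0 < μ.real {1})
    (hfin : (stepSupport μ).Finite) {d : ℝ} (hd : 0 < d) {c : ℝ} (hc : 0 < c)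
    (hpoly : ∀ n : ℕ, 1 ≤ n → c * (n : ℝ) ^ d ≤ ballCard (stepSupport μ) n) :
    ∃ C₁ > (0 : ℝ), ∀ (Ω : Type*) [MeasurableSpace Ω] (P : Measure Ω) [IsProbabilityMeasure P]
      (S : ℕ → Ω → G), IsGeneralizedSRRW P α μ S →
        ∀ n : ℕ, 1 ≤ n → ∀ x : G, P.real {ω | S n ω = x} ≤ C₁ * (n : ℝ) ^ (-(d / 2)) := by
  obtain ⟨δ, hδ, hword⟩ := wordLaw_le_of_polynomialGrowth μ hone hfin hd hc hpoly
  have hq : 0 < 1 - α := by linarith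
  obtain ⟨C, hC, hexp⟩ := exists_exp_neg_le_mul_rpow (a := d / 2) (c := (1 - α) ^ 3 / 1024)
    (by positivity) (by positivity)
  set ε := (1 - α) ^ 2 / 256 with hε
  have hε0 : 0 < ε := by positivity
  refine ⟨(δ * ε / 2) ^ (-(d / 2)) + ε ^ (-(d / 2)) + 3 * C, by positivity,
    fun Ω _ P _ S hS n hn x => ?_⟩
  have hn0 : (0 : ℝ) < n := by exact_mod_cast hn
  have hd2 : -(d / 2) ≤ 0 := by linarith
  have hnd : 0 < (n : ℝ) ^ (-(d / 2)) := Real.rpow_pos_of_pos hn0 _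
  have hp1 : 0 < (δ * ε / 2) ^ (-(d / 2)) := Real.rpow_pos_of_pos (by positivity) _
  have hp2 : 0 < ε ^ (-(d / 2)) := Real.rpow_pos_of_pos hε0 _
  rcases lt_or_ge (ε * n) 1 with hsmall | hlarge
  · refine measureReal_le_one.trans ?_
    have h1 := Real.rpow_le_rpow_of_nonpos (by positivity) hsmall.le hd2
    rw [Real.one_rpow, Real.mul_rpow hε0.le hn0.le] at h1
    nlinarith [mul_pos hp1 hnd, mul_pos hC hnd]
  · set k := ⌊ε * n⌋₊ with hk
    have hkle : (k : ℝ) ≤ ε * n := Nat.floor_le (by positivity)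
    have hk1 : 1 ≤ k := Nat.one_le_floor_iff _ |>.2 hlarge
    have hkge : ε * n / 2 ≤ k := by
      have h1 := (Nat.lt_floor_add_one (ε * n)).le
      have h2 : (1 : ℝ) ≤ k := by exact_mod_cast hk1
      rw [← hk] at h1
      linarith
    have h1 := hS.measure_eq_le hα₀ hα₁ hn hkle x (Real.rpow_nonneg (by positivity) _)
      fun l hl => hword l n k hk1 hl x
    have h2 : (δ * k) ^ (-(d / 2)) ≤ (δ * ε / 2) ^ (-(d / 2)) * (n : ℝ) ^ (-(d / 2)) := by
      rw [← Real.mul_rpow (by positivity) hn0.le]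
      refine Real.rpow_le_rpow_of_nonpos (by positivity) ?_ hd2
      have := mul_le_mul_of_nonneg_left hkge hδ.le
      linarith
    have h3 := hexp n hn0
    nlinarith [mul_pos hp2 hnd]

theorem exists_measure_eq_le_of_exponentialGrowth (hα₀ : 0 ≤ α) (hα₁ : α < 1)
    (hone : 0 < μ.real {1}) (hfin : (stepSupport μ).Finite)
    (hgrow : HasExponentialGrowth (stepSupport μ)) :
    ∃ C₂ > (0 : ℝ), ∃ C₃ > (0 : ℝ),
      ∀ (Ω : Type*) [MeasurableSpace Ω] (P : Measure Ω) [IsProbabilityMeasure P]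
        (S : ℕ → Ω → G), IsGeneralizedSRRW P α μ S →
          ∀ n : ℕ, 1 ≤ n → ∀ x : G,
            P.real {ω | S n ω = x} ≤ C₂ * Real.exp (-(C₃ * (n : ℝ) ^ (1 / 3 : ℝ))) := by
  obtain ⟨δ, hδ, K, hword⟩ := wordLaw_le_of_exponentialGrowth μ hone hfin hgrow
  have hq : 0 < 1 - α := by linarith
  set ε := (1 - α) ^ 2 / 256 with hε
  have hε0 : 0 < ε := by positivity
  set c₀ := (1 - α) ^ 3 / 1024 with hc₀
  have hc₀0 : 0 < c₀ := by positivity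
  refine ⟨Real.exp (K + δ ^ (1 / 3 : ℝ)) + 3, by positivity, min ((δ * ε) ^ (1 / 3 : ℝ)) c₀,
    lt_min (by positivity) hc₀0, fun Ω _ P _ S hS n hn x => ?_⟩
  have hn1 : (1 : ℝ) ≤ n := by exact_mod_cast hn
  set m := min ((δ * ε) ^ (1 / 3 : ℝ)) c₀
  set k := ⌊ε * n⌋₊ with hk
  have hkle : (k : ℝ) ≤ ε * n := Nat.floor_le (by positivity)
  have hkge : ε * n ≤ k + 1 := (Nat.lt_floor_add_one (ε * n)).le
  have h1 := hS.measure_eq_le hα₀ hα₁ hn hkle x (Real.exp_pos _).le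
    fun l hl => hword l n k hl x
  have hroot : m * (n : ℝ) ^ (1 / 3 : ℝ) ≤ (δ * k) ^ (1 / 3 : ℝ) + δ ^ (1 / 3 : ℝ) := by
    calc m * (n : ℝ) ^ (1 / 3 : ℝ) ≤ (δ * ε) ^ (1 / 3 : ℝ) * (n : ℝ) ^ (1 / 3 : ℝ) := by
          gcongr; exact min_le_left _ _
      _ = (δ * ε * n) ^ (1 / 3 : ℝ) := (Real.mul_rpow (by positivity) (by positivity)).symm
      _ ≤ (δ * k + δ) ^ (1 / 3 : ℝ) := by
          refine Real.rpow_le_rpow (by positivity) ?_ (by norm_num)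
          nlinarith
      _ ≤ _ := Real.rpow_add_le_add_rpow (by positivity) hδ.le (by norm_num) (by norm_num)
  have hlin : m * (n : ℝ) ^ (1 / 3 : ℝ) ≤ c₀ * n := by
    refine mul_le_mul (min_le_right _ _) ?_ (by positivity) hc₀0.le
    calc (n : ℝ) ^ (1 / 3 : ℝ) ≤ (n : ℝ) ^ (1 : ℝ) :=
          Real.rpow_le_rpow_of_exponent_le hn1 (by norm_num)
      _ = n := Real.rpow_one _
  have h2 : Real.exp (K - (δ * k) ^ (1 / 3 : ℝ)) ≤
      Real.exp (K + δ ^ (1 / 3 : ℝ)) * Real.exp (-(m * (n : ℝ) ^ (1 / 3 : ℝ))) := by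
    rw [← Real.exp_add]
    exact Real.exp_le_exp.2 (by linarith)
  have h3 : Real.exp (-(c₀ * n)) ≤ Real.exp (-(m * (n : ℝ) ^ (1 / 3 : ℝ))) :=
    Real.exp_le_exp.2 (by linarith)
  linarith

theorem exists_measure_eq_le_of_nonamenable (hα₀ : 0 ≤ α) (hα₁ : α < 1) (hone : 0 < μ.real {1})
    (hfin : (stepSupport μ).Finite) (hna : IsNonamenableCayley (stepSupport μ)) :
    ∃ C₄ > (0 : ℝ), ∃ C₅ > (0 : ℝ),
      ∀ (Ω : Type*) [MeasurableSpace Ω] (P : Measure Ω) [IsProbabilityMeasure P]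
        (S : ℕ → Ω → G), IsGeneralizedSRRW P α μ S →
          ∀ n : ℕ, 1 ≤ n → ∀ x : G,
            P.real {ω | S n ω = x} ≤ C₄ * Real.exp (-(C₅ * (n : ℝ))) := by
  obtain ⟨δ, hδ, hword⟩ := wordLaw_le_of_nonamenable μ hone hfin hna
  have hq : 0 < 1 - α := by linarith
  set ε := (1 - α) ^ 2 / 256 with hε
  have hε0 : 0 < ε := by positivity
  set c₀ := (1 - α) ^ 3 / 1024 with hc₀
  have hc₀0 : 0 < c₀ := by positivity
  refine ⟨Real.exp δ + 3, by positivity, min (δ * ε) c₀,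
    lt_min (by positivity) hc₀0, fun Ω _ P _ S hS n hn x => ?_⟩
  set m := min (δ * ε) c₀
  set k := ⌊ε * n⌋₊ with hk
  have hkle : (k : ℝ) ≤ ε * n := Nat.floor_le (by positivity)
  have hkge : ε * n ≤ k + 1 := (Nat.lt_floor_add_one (ε * n)).le
  have h1 := hS.measure_eq_le hα₀ hα₁ hn hkle x (Real.exp_pos _).le
    fun l hl => hword l n k hl x
  have hm1 : m * n ≤ δ * ε * n := by gcongr; exact min_le_left _ _
  have hm2 : m * n ≤ c₀ * n := by gcongr; exact min_le_right _ _
  have h2 : Real.exp (-(δ * k)) ≤ Real.exp δ * Real.exp (-(m * n)) := by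
    rw [← Real.exp_add]
    refine Real.exp_le_exp.2 ?_
    have := mul_le_mul_of_nonneg_left hkge hδ.le
    linarith
  have h3 : Real.exp (-(c₀ * n)) ≤ Real.exp (-(m * n)) := Real.exp_le_exp.2 (by linarith)
  linarith

end Main

end SRRW

theorem corollary1p5 {G : Type*} [Group G] [Countable G] [Infinite G]
    [MeasurableSpace G] [DiscreteMeasurableSpace G]
    (μ : Measure G) [IsProbabilityMeasure μ] (α : ℝ) (hα₀ : 0 ≤ α) (hα₁ : α < 1)
    (hirr : SRRW.IsIrreducibleStep μ)
    (hlazy : ∃ μ₀ : ℝ, 0 < μ₀ ∧ μ₀ ≤ 1 / 2 ∧ μ₀ ≤ μ.real {1})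
    (hfin : (SRRW.stepSupport μ).Finite)
    (hgen : Subgroup.closure (SRRW.stepSupport μ) = ⊤) :
    (∀ d : ℝ, 1 ≤ d → SRRW.HasPolynomialGrowth (SRRW.stepSupport μ) d →
      ∃ C₁ > (0 : ℝ), ∀ (Ω : Type*) [MeasurableSpace Ω] (P : Measure Ω) [IsProbabilityMeasure P]
        (S : ℕ → Ω → G), SRRW.IsGeneralizedSRRW P α μ S →
          ∀ n : ℕ, 1 ≤ n → ∀ x : G, P.real {ω | S n ω = x} ≤ C₁ * (n : ℝ) ^ (-(d / 2))) ∧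
    (SRRW.HasAtLeastCubicGrowth (SRRW.stepSupport μ) →
      ∀ (Ω : Type*) [MeasurableSpace Ω] (P : Measure Ω) [IsProbabilityMeasure P]
        (S : ℕ → Ω → G), SRRW.IsGeneralizedSRRW P α μ S → SRRW.IsTransient P S) ∧
    (SRRW.HasExponentialGrowth (SRRW.stepSupport μ) →
      ∃ C₂ > (0 : ℝ), ∃ C₃ > (0 : ℝ),
        ∀ (Ω : Type*) [MeasurableSpace Ω] (P : Measure Ω) [IsProbabilityMeasure P]
          (S : ℕ → Ω → G), SRRW.IsGeneralizedSRRW P α μ S →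
            ∀ n : ℕ, 1 ≤ n → ∀ x : G,
              P.real {ω | S n ω = x} ≤ C₂ * Real.exp (-(C₃ * (n : ℝ) ^ (1 / 3 : ℝ)))) ∧
    (SRRW.IsNonamenableCayley (SRRW.stepSupport μ) →
      ∃ C₄ > (0 : ℝ), ∃ C₅ > (0 : ℝ),
        ∀ (Ω : Type*) [MeasurableSpace Ω] (P : Measure Ω) [IsProbabilityMeasure P]
          (S : ℕ → Ω → G), SRRW.IsGeneralizedSRRW P α μ S →
            ∀ n : ℕ, 1 ≤ n → ∀ x : G,
              P.real {ω | S n ω = x} ≤ C₄ * Real.exp (-(C₅ * (n : ℝ)))) := by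
  have hone : 0 < μ.real {1} := by
    obtain ⟨μ₀, h0, -, h1⟩ := hlazy
    exact h0.trans_le h1
  refine ⟨fun d hd ⟨c, hc, C, _, hgrow⟩ => ?_, fun ⟨c, hc, hgrow⟩ Ω _ P _ S hS => ?_,
    fun hgrow => ?_, fun hna => ?_⟩
  · exact SRRW.exists_measure_eq_le_of_polynomialGrowth hα₀ hα₁ hone hfin (by linarith) hc
      fun n hn => (hgrow n hn).1
  · obtain ⟨C, -, hbound⟩ := SRRW.exists_measure_eq_le_of_polynomialGrowth (d := 3) hα₀ hα₁
      hone hfin (by norm_num) hc fun n hn => by exact_mod_cast hgrow n hn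
    refine SRRW.isTransient_of_summable fun x => ?_
    have hsum : Summable fun n : ℕ => C * (n : ℝ) ^ (-(3 / 2 : ℝ)) :=
      (Real.summable_nat_rpow.2 (by norm_num)).mul_left C
    rw [← summable_nat_add_iff 1] at hsum ⊢
    exact Summable.of_nonneg_of_le (fun _ => measureReal_nonneg)
      (fun n => hbound Ω P S hS (n + 1) (by omega) x) hsum
  · exact SRRW.exists_measure_eq_le_of_exponentialGrowth hα₀ hα₁ hone hfin hgrow
  · exact SRRW.exists_measure_eq_le_of_nonamenable hα₀ hα₁ hone hfin hna
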